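/- **Model.** Let $K\in\mathbb N\cup\{\infty\}$, $\lambda,\mu_1,\mu_2>0$, $p_1,p_2\ge 0$, $p_1+p_2=1$, and assume $2\lambda<\mu_1+\mu_2$ if $K=\infty$. Consider two parallel one-server queues of capacity $K$, with exponential services at rates $\mu_1,\mu_2$ and Poisson arrivals at rate $2\lambda$. An arriving customer joins the shorter queue; if both queues have the same length $<K$, it joins queue $i$ with probability $p_i$; if both have length $K$, it is rejected. Let $\pi$ be a stationary distribution of the Markov process $(L_1,L_2)$ of queue lengths, i.e. a probability distribution on $\{(i,j)\in\mathbb N^2: i,j\le K\}$ solving the balance equations. Below, $\pi(K,K)$ is read as $0$ if $K=\infty$, sums $\sum_{l=k}^{\infty}$ have finitely many nonzero terms in (i), and $f^{*m}$ denotes the $m$-fold convolution power of $f:\mathbb N\to\mathbb R$, $(f*h)(n)=\sum_{m=0}^n f(m)h(n-m)$. Put $$g_1(j)=-\frac{\mu_1}{\mu_2}\,\frac{\xi_{1+}^j-\xi_{1-}^j}{\xi_{1+}-\xi_{1-}},\qquad g_2(j)=-\frac{\mu_2}{\mu_1}\,\frac{\xi_{2+}^j-\xi_{2-}^j}{\xi_{2+}-\xi_{2-}}\qquad(j\in\mathbb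 N),$$ where $\xi_{1\pm}$ are the roots of $\mu_2X^2-(2\lambda+\mu_1+\mu_2)X+2\lambda$ and $\xi_{2\pm}$ those of $\mu_1X^2-(2\lambda+\mu_1+\mu_2)X+2\lambda$. **(i)** For $0\le j<k<K+1$, $$\pi(k,j)=\frac{\mu_2}{\mu_1}\sum_{l=k}^{K}\pi(l,0)\bigl(g_1^{*(l-k+1)}(j)-g_1^{*(l-k+1)}(j+1)\bigr),\qquad \pi(j,k)=\frac{\mu_1}{\mu_2}\sum_{l=k}^{K}\pi(0,l)\bigl(g_2^{*(l-k+1)}(j)-g_2^{*(l-k+1)}(j+1)\bigr);$$ for $0\le k<K$, $$\pi(k,k)=-\frac1{2\lambda}\sum_{l=k+1}^{K}\bigl(\mu_2\,\pi(l,0)\,g_1^{*(l-k)}(k+1)+\mu_1\,\pi(0,l)\,g_2^{*(l-k)}(k+1)\bigr);$$ and, if $1\le K<\infty$, $$\pi(K,K)=\frac{2\lambda}{\mu_1+\mu_2}\Bigl(\frac{\mu_2}{\mu_1}\pi(K,0)\bigl(g_1(K-1)-g_1(K)\bigr)+\frac{\mu_1}{\mu_2}\pi(0,K)\bigl(g_2(K-1)-g_2(K)\bigr)\Bigr).$$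 **(ii)** For $x\in\mathbb C$ let $y_1,z_1$ be the roots of $p_{x,1}(Y)=\mu_2Y^2-(2\lambda+\mu_1+\mu_2)xY+(\mu_1+2\lambda x)x$ and $y_2,z_2$ those of $p_{x,2}(Y)=\mu_1Y^2-(2\lambda+\mu_1+\mu_2)xY+(\mu_2+2\lambda x)x$. For real sequences $a=(a_k)_{0\le k<K+1}$, $b=(b_k)_{0\le k<K+1}$ and $\kappa\in\mathbb R$ (with $\kappa=0$ if $K=\infty$), put $A_1(y)=\sum_{k=0}^Ka_ky^k$, $A_2(y)=\sum_{k=0}^Kb_ky^k$, and consider the following relations, required (together with absolute convergence of the series) for all $x\ne0$ with $|x|$ sufficiently small: $$\frac{\mu_2}{y_1-z_1}\bigl((y_1-x)A_1(y_1)-(z_1-x)A_1(z_1)\bigr)=\mu_2x^K\kappa+\frac{\mu_2+2p_1\lambda x}{2\lambda}\Bigl(\mu_1\frac{A_1(y_1)-A_1(z_1)}{y_1-z_1}+\mu_2\frac{A_2(y_2)-A_2(z_2)}{y_2-z_2}\Bigr),$$ $$\frac{\mu_1}{y_2-z_2}\bigl((y_2-x)A_2(y_2)-(z_2-x)A_2(z_2)\bigr)=\mu_1x^K\kappa+\frac{\mu_1+2p_2\lambda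 x}{2\lambda}\Bigl(\mu_1\frac{A_1(y_1)-A_1(z_1)}{y_1-z_1}+\mu_2\frac{A_2(y_2)-A_2(z_2)}{y_2-z_2}\Bigr),$$ where the terms in $x^K\kappa$ are absent if $K=\infty$. These relations hold for $a_k=\pi(k,0)$, $b_k=\pi(0,k)$, $\kappa=\pi(K,K)$, and they characterize these values up to a common multiplicative constant: $(a,b,\kappa)$ satisfies them (and, if $K=\infty$, the array on $\mathbb N^2$ built from $a,b$ in place of $\pi(\cdot,0),\pi(0,\cdot)$ by the formulas of (i) is absolutely summable) if and only if there is $c\in\mathbb R$ with $a_k=c\,\pi(k,0)$ and $b_k=c\,\pi(0,k)$ for all $0\le k<K+1$, and $\kappa=c\,\pi(K,K)$. **(iii)** For $a_k=\pi(k,0)$, $b_k=\pi(0,k)$, $\kappa=\pi(K,K)$, the normalization relation $$\mu_2A_1(1)+\mu_1A_2(1)=\mu_1+\mu_2-2\lambda(1-\kappa)$$ holds (with convergent series). If $2\lambda\neq\mu_1+\mu_2$, it completes the characterization: $(a,b,\kappa)$ satisfies the conditions of (ii) and this relation if and only if $a_k=\pi(k,0)$, $b_k=\pi(0,k)$ for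 all $0\le k<K+1$, and $\kappa=\pi(K,K)$. -/

import Mathlib

open Filter Topology Polynomial

noncomputable section

namespace JSQ

/-- Jump rate from `v = (L₁, L₂)` to `w` for two parallel queues with capacity `K` (possibly `⊤`).
Arrivals (total rate `2 * lam`) join the shorter queue; in case of equality below the capacity they
join queue `i` with probability `pᵢ`; at `(K, K)` they are rejected. Queue `i`, when
non-empty, is served at rate `μᵢ`. -/
def rate (K : ℕ∞) (lam μ₁ μ₂ p₁ p₂ : ℝ) (v w : ℕ × ℕ) : ℝ :=
  (if w = (v.1 + 1, v.2) then
      if v.1 < v.2 then 2 * lam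
      else if v.1 = v.2 ∧ (v.1 : ℕ∞) < K then 2 * lam * p₁ else 0
    else 0) +
  (if w = (v.1, v.2 + 1) then
      if v.2 < v.1 then 2 * lam
      else if v.1 = v.2 ∧ (v.1 : ℕ∞) < K then 2 * lam * p₂ else 0
    else 0) +
  (if v = (w.1 + 1, w.2) then μ₁ else 0) +
  (if v = (w.1, w.2 + 1) then μ₂ else 0)

/-- Stationary distribution of the queue-length process: a probability distribution on the state
space `{0, …, K}²` (extended by zero to `ℕ × ℕ`) solving the global balance equations
`π Q = 0`. The rates are bounded, so this is invariance for the process. -/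
structure IsStationary (K : ℕ∞) (lam μ₁ μ₂ p₁ p₂ : ℝ) (π : ℕ × ℕ → ℝ) : Prop where
  nonneg : ∀ v, 0 ≤ π v
  support : ∀ v : ℕ × ℕ, ¬ ((v.1 : ℕ∞) ≤ K ∧ (v.2 : ℕ∞) ≤ K) → π v = 0
  hasSum_one : HasSum π 1
  balance : ∀ w, HasSum (fun v => π v * rate K lam μ₁ μ₂ p₁ p₂ v w)
    (π w * ∑' u, rate K lam μ₁ μ₂ p₁ p₂ w u)

/-- Discrete convolution of functions on `ℕ`. -/
def conv (φ ψ : ℕ → ℝ) (n : ℕ) : ℝ :=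
  ∑ m ∈ Finset.range (n + 1), φ m * ψ (n - m)

/-- `convPow φ k` is the `k`-fold convolution of `φ` with itself. -/
def convPow (φ : ℕ → ℝ) : ℕ → ℕ → ℝ
  | 0 => fun n => if n = 0 then 1 else 0
  | k + 1 => conv φ (convPow φ k)

/-- The larger root of `ν X² - (2 lam + μ + ν) X + 2 lam`. -/
def xiPlus (lam μ ν : ℝ) : ℝ :=
  ((2 * lam + μ + ν) + Real.sqrt ((2 * lam + μ + ν) ^ 2 - 8 * lam * ν)) / (2 * ν)

/-- The smaller root of `ν X² - (2 lam + μ + ν) X + 2 lam`. -/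
def xiMinus (lam μ ν : ℝ) : ℝ :=
  ((2 * lam + μ + ν) - Real.sqrt ((2 * lam + μ + ν) ^ 2 - 8 * lam * ν)) / (2 * ν)

/-- With `(μ, ν) = (μ₁, μ₂)` this is `g₁`, with `(μ, ν) = (μ₂, μ₁)` it is `g₂`. -/
def g (lam μ ν : ℝ) (j : ℕ) : ℝ :=
  -(μ / ν) * ((xiPlus lam μ ν ^ j - xiMinus lam μ ν ^ j) / (xiPlus lam μ ν - xiMinus lam μ ν))

/-- `∑_{l=k}^{K} a(l) (φ^{*(l-k+1)}(j) - φ^{*(l-k+1)}(j+1))`. -/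
def offDiagSum (K : ℕ∞) (φ a : ℕ → ℝ) (k j : ℕ) : ℝ :=
  ∑' l : {l : ℕ // k ≤ l ∧ (l : ℕ∞) ≤ K},
    a l * (convPow φ (l - k + 1) j - convPow φ (l - k + 1) (j + 1))

/-- `-(1/(2 lam)) ∑_{l=k+1}^{K} (μ₂ a(l) g₁^{*(l-k)}(k+1) + μ₁ b(l) g₂^{*(l-k)}(k+1))`. -/
def diagSum (K : ℕ∞) (lam μ₁ μ₂ : ℝ) (a b : ℕ → ℝ) (k : ℕ) : ℝ :=
  -(1 / (2 * lam)) * ∑' l : {l : ℕ // k + 1 ≤ l ∧ (l : ℕ∞) ≤ K},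
    (μ₂ * a l * convPow (g lam μ₁ μ₂) (l - k) (k + 1)
      + μ₁ * b l * convPow (g lam μ₂ μ₁) (l - k) (k + 1))

/-- For infinite capacity, the array on `ℕ × ℕ` built from sequences `a` (in the role of `π(·,0)`)
and `b` (in the role of `π(0,·)`) by the explicit formulas. -/
def extension (lam μ₁ μ₂ : ℝ) (a b : ℕ → ℝ) (v : ℕ × ℕ) : ℝ :=
  if v.2 < v.1 then μ₂ / μ₁ * offDiagSum ⊤ (g lam μ₁ μ₂) a v.1 v.2
  else if v.1 < v.2 then μ₁ / μ₂ * offDiagSum ⊤ (g lam μ₂ μ₁) b v.2 v.1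
  else diagSum ⊤ lam μ₁ μ₂ a b v.1

/-- Terms of the generating function `∑_{0 ≤ k < K+1} a(k) y^k`. -/
def genTerm (K : ℕ∞) (a : ℕ → ℝ) (y : ℂ) (k : ℕ) : ℂ :=
  if (k : ℕ∞) ≤ K then (a k : ℂ) * y ^ k else 0

/-- The generating function `∑_{0 ≤ k < K+1} a(k) y^k`. -/
def gen (K : ℕ∞) (a : ℕ → ℝ) (y : ℂ) : ℂ := ∑' k, genTerm K a y k

/-- `π(K, K)`, to be read as `0` if `K = ⊤`. -/
def corner (K : ℕ∞) (π : ℕ × ℕ → ℝ) : ℝ :=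
  if K = ⊤ then 0 else π (K.toNat, K.toNat)

/-- `ν Y² - (2 lam + μ + ν) x Y + (μ + 2 lam x) x`: with `(μ, ν) = (μ₁, μ₂)` this is `p_{x,1}`, with
`(μ, ν) = (μ₂, μ₁)` it is `p_{x,2}`. -/
def poly (lam μ ν : ℝ) (x : ℂ) : ℂ[X] :=
  C (ν : ℂ) * X ^ 2 - C ((2 * lam + μ + ν : ℂ) * x) * X + C ((μ + 2 * lam * x : ℂ) * x)

/-- The pair of functional equations at a point `x`, at given roots, for boundary sequences `a`, `b`
and blocking value `κ` (in the roles of `π(·,0)`, `π(0,·)` and `π(K,K)`). -/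
def FunctionalEquations (K : ℕ∞) (lam μ₁ μ₂ p₁ p₂ : ℝ) (a b : ℕ → ℝ) (κ : ℝ)
    (x y₁ z₁ y₂ z₂ : ℂ) : Prop :=
  let A₁ := gen K a
  let A₂ := gen K b
  let D : ℂ := μ₁ * ((A₁ y₁ - A₁ z₁) / (y₁ - z₁)) + μ₂ * ((A₂ y₂ - A₂ z₂) / (y₂ - z₂))
  (μ₂ / (y₁ - z₁) * ((y₁ - x) * A₁ y₁ - (z₁ - x) * A₁ z₁)
      = μ₂ * x ^ K.toNat * κ + (μ₂ + 2 * p₁ * lam * x) / (2 * lam) * D) ∧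
  (μ₁ / (y₂ - z₂) * ((y₂ - x) * A₂ y₂ - (z₂ - x) * A₂ z₂)
      = μ₁ * x ^ K.toNat * κ + (μ₁ + 2 * p₂ * lam * x) / (2 * lam) * D)

/-- The functional equations hold (with convergent generating functions) for all `x ≠ 0` with `|x|`
sufficiently small. At `x = 0` both polynomials have a double root and the quotients are undefined;
for small `x ≠ 0` the roots are simple. -/
def BoundaryRelations (K : ℕ∞) (lam μ₁ μ₂ p₁ p₂ : ℝ) (a b : ℕ → ℝ) (κ : ℝ) : Prop :=
  ∀ᶠ x : ℂ in 𝓝[≠] 0, ∀ y₁ z₁ y₂ z₂ : ℂ,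
    (poly lam μ₁ μ₂ x).roots = {y₁, z₁} → (poly lam μ₂ μ₁ x).roots = {y₂, z₂} →
      Summable (genTerm K a y₁) ∧ Summable (genTerm K a z₁) ∧
      Summable (genTerm K b y₂) ∧ Summable (genTerm K b z₂) ∧
      FunctionalEquations K lam μ₁ μ₂ p₁ p₂ a b κ x y₁ z₁ y₂ z₂

/-- The normalization relation (with convergent series). -/
def Normalization (K : ℕ∞) (lam μ₁ μ₂ : ℝ) (a b : ℕ → ℝ) (κ : ℝ) : Prop :=
  Summable (genTerm K a 1) ∧ Summable (genTerm K b 1) ∧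
    (μ₂ * gen K a 1 + μ₁ * gen K b 1 : ℂ) = μ₁ + μ₂ - 2 * lam * (1 - κ)

/-! Sanity facts: `xiPlus`, `xiMinus` are the two distinct roots, and the sums above only have
finitely many non-zero terms, so that `tsum` is the genuine sum. -/

theorem discr_pos {lam μ ν : ℝ} (hl : 0 < lam) (hμ : 0 < μ) (hν : 0 < ν) :
    0 < (2 * lam + μ + ν) ^ 2 - 8 * lam * ν := by
  nlinarith [sq_nonneg (2 * lam - ν), mul_pos hl hμ, mul_pos hμ hν, mul_pos hμ hμ]

theorem xi_ne {lam μ ν : ℝ} (hl : 0 < lam) (hμ : 0 < μ) (hν : 0 < ν) :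
    xiMinus lam μ ν < xiPlus lam μ ν := by
  unfold xiMinus xiPlus
  have := Real.sqrt_pos.2 (discr_pos hl hμ hν)
  gcongr
  linarith

theorem xi_roots {lam μ ν : ℝ} (hl : 0 < lam) (hμ : 0 < μ) (hν : 0 < ν) :
    (ν * xiPlus lam μ ν ^ 2 - (2 * lam + μ + ν) * xiPlus lam μ ν + 2 * lam = 0) ∧
    (ν * xiMinus lam μ ν ^ 2 - (2 * lam + μ + ν) * xiMinus lam μ ν + 2 * lam = 0) := by
  have h := Real.sq_sqrt (discr_pos hl hμ hν).le
  unfold xiMinus xiPlus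
  constructor <;> field_simp <;> ring_nf <;> ring_nf at h <;> rw [h] <;> ring

theorem convPow_eq_zero {φ : ℕ → ℝ} (h0 : φ 0 = 0) :
    ∀ (k j : ℕ), j < k → convPow φ k j = 0
  | 0, j, h => absurd h (Nat.not_lt_zero j)
  | k + 1, j, h => by
    change ∑ m ∈ Finset.range (j + 1), φ m * convPow φ k (j - m) = 0
    refine Finset.sum_eq_zero fun m hmem => ?_
    rcases Nat.eq_zero_or_pos m with rfl | hm
    · rw [h0, zero_mul]
    · by_cases hj : j - m < k
      · rw [convPow_eq_zero h0 k _ hj, mul_zero]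
      · have := Finset.mem_range.1 hmem
        omega

theorem g_zero (lam μ ν : ℝ) : g lam μ ν 0 = 0 := by simp [g]

theorem summable_offDiagSum (K : ℕ∞) {φ : ℕ → ℝ} (h0 : φ 0 = 0) (a : ℕ → ℝ) (k j : ℕ) :
    Summable fun l : {l : ℕ // k ≤ l ∧ (l : ℕ∞) ≤ K} =>
      a l * (convPow φ (l - k + 1) j - convPow φ (l - k + 1) (j + 1)) := by
  refine summable_of_hasFiniteSupport (((Set.finite_Iio (k + j + 2)).preimage
    Subtype.val_injective.injOn).subset fun l hl => ?_)
  by_contra h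
  have h' : k + j + 2 ≤ (l : ℕ) := not_lt.1 h
  exact hl (by
    beta_reduce
    rw [convPow_eq_zero h0 _ _ (by omega), convPow_eq_zero h0 _ _ (by omega), sub_zero, mul_zero])

theorem summable_diagSum (K : ℕ∞) (lam μ₁ μ₂ : ℝ) (a b : ℕ → ℝ) (k : ℕ) :
    Summable fun l : {l : ℕ // k + 1 ≤ l ∧ (l : ℕ∞) ≤ K} =>
      (μ₂ * a l * convPow (g lam μ₁ μ₂) (l - k) (k + 1)
        + μ₁ * b l * convPow (g lam μ₂ μ₁) (l - k) (k + 1)) := by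
  refine summable_of_hasFiniteSupport (((Set.finite_Iio (2 * k + 2)).preimage
    Subtype.val_injective.injOn).subset fun l hl => ?_)
  by_contra h
  have h' : 2 * k + 2 ≤ (l : ℕ) := not_lt.1 h
  exact hl (by
    beta_reduce
    rw [convPow_eq_zero (g_zero _ _ _) _ _ (by omega),
      convPow_eq_zero (g_zero _ _ _) _ _ (by omega), mul_zero, mul_zero, add_zero])

end JSQ

end

/-! Below the diagonal the balance equations form a second-order recursion in the shorter length, in
which the values for k + 1 appear as the inhomogeneity. With s = 2λ + μ + ν, the series G = ∑ g(n)
Xⁿ satisfies (ν - sX + 2λX²) G = -μX. Hence (ν - sX + 2λX²) G^(m+1) = -μX G^m (`convPow_g_rec`), and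
c(k, n) = ∑_m a(k+m) g^{*(m+1)}(n) turns this into the required recursion. The differences
(ν/μ)(c(k, j) - c(k, j+1)) solve the interior equations with value a(k) at j = 0, and row by row
nothing else does (`Balanced.eq_tri`).

The differences telescope in j. So the cut equation across max(L₁, L₂) = k, namely 2λ π(k,k) = μ₁
∑_{j≤k} π(k+1,j) + μ₂ ∑_{j≤k} π(j,k+1) for k < K, becomes the diagonal formula
(`Balanced.eq_triDiag`). What remains are the equations next to the diagonal, where the two
triangles meet. They are one scalar relation per k and per queue (`CoeffRelation`); conversely,
these relations suffice for the array built from the boundary data to be balanced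
(`balanced_array`).

The functional equations are the generating functions in x of these relations. After interchanging
sums, the coefficient of a(l) in ∑_k c(k+1, k+1) x^k is a polynomial in x that equals -(μ/ν)(y^l -
z^l)/(y - z), because it obeys the linear recursion with characteristic roots y, z
(`sum_convPow_mul_pow`). Uniqueness of power series gives the equivalence (`boundaryRelations_iff`).

Finally, summable balanced arrays form a line: if h is one, then |h| is sub-invariant, hence
invariant, and a zero at the origin spreads to all states (`Balanced.eq_zero`). The normalization
equates the mean rates of accepted arrivals and of departures, and it fixes the remaining factor
when 2λ ≠ μ₁ + μ₂. -/

noncomputable section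

namespace JSQ

/-! ### Convolution powers of g and the recursions below the diagonal -/

section Algebra

variable {lam μ ν : ℝ}

theorem g_one (hl : 0 < lam) (hμ : 0 < μ) (hν : 0 < ν) : g lam μ ν 1 = -(μ / ν) := by
  have h := sub_ne_zero.2 (xi_ne hl hμ hν).ne'
  simp [g, div_self h]

theorem g_rec (hl : 0 < lam) (hμ : 0 < μ) (hν : 0 < ν) (n : ℕ) :
    ν * g lam μ ν (n + 2) - (2 * lam + μ + ν) * g lam μ ν (n + 1) + 2 * lam * g lam μ ν n = 0 := by
  obtain ⟨h₁, h₂⟩ := xi_roots hl hμ hν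
  unfold g
  linear_combination -(μ / ν) * (xiPlus lam μ ν - xiMinus lam μ ν)⁻¹ *
    (xiPlus lam μ ν ^ n * h₁ - xiMinus lam μ ν ^ n * h₂)

theorem convPow_one (φ : ℕ → ℝ) (n : ℕ) : convPow φ 1 n = φ n := by
  change ∑ m ∈ Finset.range (n + 1), φ m * (if n - m = 0 then 1 else 0) = φ n
  rw [Finset.sum_eq_single_of_mem n (by simp) fun m hm hne => ?_]
  · simp
  · have := Finset.mem_range.1 hm
    rw [if_neg (by omega), mul_zero]

/-- Coefficient of X^(n+2) in (ν - sX + 2λX²) G^(m+1) = -μX G^m. The left factor of the convolution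
obeys the homogeneous recursion, and only its start g(0) = 0, g(1) = -μ/ν leaves a contribution. -/
theorem convPow_g_rec (hl : 0 < lam) (hμ : 0 < μ) (hν : 0 < ν) (m n : ℕ) :
    ν * convPow (g lam μ ν) (m + 1) (n + 2)
      - (2 * lam + μ + ν) * convPow (g lam μ ν) (m + 1) (n + 1)
      + 2 * lam * convPow (g lam μ ν) (m + 1) n = -μ * convPow (g lam μ ν) m (n + 1) := by
  set ψ := convPow (g lam μ ν) m
  change ν * (∑ i ∈ Finset.range (n + 2 + 1), g lam μ ν i * ψ (n + 2 - i))
    - (2 * lam + μ + ν) * (∑ i ∈ Finset.range (n + 1 + 1), g lam μ ν i * ψ (n + 1 - i))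
    + 2 * lam * (∑ i ∈ Finset.range (n + 1), g lam μ ν i * ψ (n - i)) = -μ * ψ (n + 1)
  rw [Finset.sum_range_succ', Finset.sum_range_succ', Finset.sum_range_succ' _ (n + 1)]
  simp only [g_zero, zero_mul, add_zero, zero_add, g_one hl hμ hν, add_assoc, one_add_one_eq_two]
  have e₁ : ∀ i, n + 2 - (i + 2) = n - i := fun i => by omega
  have e₂ : ∀ i, n + 1 - (i + 1) = n - i := fun i => by omega
  have e₃ : n + 2 - 1 = n + 1 := by omega
  simp only [e₁, e₂, e₃]
  have key : ν * (∑ i ∈ Finset.range (n + 1), g lam μ ν (i + 2) * ψ (n - i))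
      - (2 * lam + μ + ν) * (∑ i ∈ Finset.range (n + 1), g lam μ ν (i + 1) * ψ (n - i))
      + 2 * lam * (∑ i ∈ Finset.range (n + 1), g lam μ ν i * ψ (n - i)) = 0 := by
    rw [Finset.mul_sum, Finset.mul_sum, Finset.mul_sum, ← Finset.sum_sub_distrib,
      ← Finset.sum_add_distrib]
    refine Finset.sum_eq_zero fun i _ => ?_
    linear_combination ψ (n - i) * g_rec hl hμ hν i
  have : ν * (μ / ν) = μ := by field_simp
  linear_combination key - ψ (n + 1) * this

theorem convPow_g_zero_right (m : ℕ) : convPow (g lam μ ν) (m + 1) 0 = 0 :=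
  convPow_eq_zero (g_zero _ _ _) _ _ (Nat.succ_pos m)

/-- A geometric bound for the convolution powers of `g`. -/
theorem exists_abs_convPow_g_le (hl : 0 < lam) (hμ : 0 < μ) (hν : 0 < ν) :
    ∃ B : ℝ, 1 ≤ B ∧ ∀ m n, |convPow (g lam μ ν) m n| ≤ B ^ n := by
  set s := 2 * lam + μ + ν
  have hs : 0 < s := by positivity
  -- This B satisfies νB ≥ s + 2λ + μ, so that one step of the recursion costs at most a factor B,
  -- uniformly in m.
  refine ⟨1 + (s + 2 * lam + μ) / ν, by
    have : 0 < (s + 2 * lam + μ) / ν := by positivity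
    linarith, ?_⟩
  set B := 1 + (s + 2 * lam + μ) / ν
  have hB : 1 ≤ B := by
    have : 0 < (s + 2 * lam + μ) / ν := by positivity
    simp only [B]; linarith
  have hνB : s + 2 * lam + μ ≤ ν * B := by
    have : ν * ((s + 2 * lam + μ) / ν) = s + 2 * lam + μ := by field_simp
    simp only [B, mul_add]; linarith
  intro m
  induction m with
  | zero =>
    intro n
    have := one_le_pow₀ hB (n := n)
    simp only [convPow]
    split_ifs <;> simp <;> linarith
  | succ m ihm =>
    -- The recursion has order two in n, so two consecutive bounds are carried.
    have base : ∀ n, |convPow (g lam μ ν) (m + 1) n| ≤ B ^ n ∧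
        |convPow (g lam μ ν) (m + 1) (n + 1)| ≤ B ^ (n + 1) := by
      intro n
      induction n with
      | zero =>
        refine ⟨by simp [convPow_g_zero_right], ?_⟩
        rcases Nat.eq_zero_or_pos m with rfl | hm
        · rw [zero_add, convPow_one, g_one hl hμ hν, abs_neg, abs_of_pos (by positivity), pow_one,
            div_le_iff₀ hν]
          nlinarith
        · rw [convPow_eq_zero (g_zero _ _ _) _ _ (by omega)]
          simp; linarith
      | succ n ih =>
        refine ⟨ih.2, ?_⟩
        have e := convPow_g_rec hl hμ hν m n
        have hm := ihm (n + 1)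
        have hp : B ^ n ≤ B ^ (n + 1) := pow_le_pow_right₀ hB (Nat.le_succ n)
        have hp0 : 0 ≤ B ^ (n + 1) := by positivity
        have h₁ : ν * |convPow (g lam μ ν) (m + 1) (n + 2)| ≤
            s * B ^ (n + 1) + 2 * lam * B ^ (n + 1) + μ * B ^ (n + 1) := by
          rw [← abs_of_pos hν, ← abs_mul, abs_of_pos hν]
          have e' : ν * convPow (g lam μ ν) (m + 1) (n + 2) =
            s * convPow (g lam μ ν) (m + 1) (n + 1) - 2 * lam * convPow (g lam μ ν) (m + 1) n
              - μ * convPow (g lam μ ν) m (n + 1) := by linear_combination e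
          rw [e']
          refine (abs_sub _ _).trans (add_le_add ((abs_sub _ _).trans (add_le_add ?_ ?_)) ?_)
          · rw [abs_mul, abs_of_pos hs]; gcongr; exact ih.2
          · rw [abs_mul, abs_of_pos (by positivity : 0 < 2 * lam)]; gcongr; exact ih.1.trans hp
          · rw [abs_mul, abs_of_pos hμ]; gcongr
        have h₂ : ν * |convPow (g lam μ ν) (m + 1) (n + 2)| ≤ ν * B ^ (n + 2) := by
          have := mul_le_mul_of_nonneg_right hνB hp0
          calc _ ≤ _ := h₁
            _ = (s + 2 * lam + μ) * B ^ (n + 1) := by ring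
            _ ≤ _ := this
            _ = _ := by ring
        exact le_of_mul_le_mul_left h₂ hν
    exact fun n => (base n).1

/-- The sums `∑_m a(k+m) g^{*(m+1)}(n)`, which have finitely many non-zero terms. -/
def convSum (lam μ ν : ℝ) (a : ℕ → ℝ) (k n : ℕ) : ℝ :=
  ∑ m ∈ Finset.range n, a (k + m) * convPow (g lam μ ν) (m + 1) n

theorem convSum_eq_sum_range (a : ℕ → ℝ) (k : ℕ) {n N : ℕ} (h : n ≤ N) :
    convSum lam μ ν a k n = ∑ m ∈ Finset.range N, a (k + m) * convPow (g lam μ ν) (m + 1) n := by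
  refine Finset.sum_subset (Finset.range_mono h) fun m _ hm => ?_
  rw [convPow_eq_zero (g_zero _ _ _) _ _ (by simp at hm; omega), mul_zero]

theorem convSum_zero_right (a : ℕ → ℝ) (k : ℕ) : convSum lam μ ν a k 0 = 0 := by
  simp [convSum]

theorem convSum_one_right (hl : 0 < lam) (hμ : 0 < μ) (hν : 0 < ν) (a : ℕ → ℝ) (k : ℕ) :
    convSum lam μ ν a k 1 = -(μ / ν) * a k := by
  simp [convSum, convPow_one, g_one hl hμ hν]; ring

/-- Lowering the convolution exponent by one amounts to moving the starting index of a from k to k +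
1, so the inhomogeneity is a sum of the same kind. -/
theorem convSum_rec (hl : 0 < lam) (hμ : 0 < μ) (hν : 0 < ν) (a : ℕ → ℝ) (k n : ℕ) :
    ν * convSum lam μ ν a k (n + 2) - (2 * lam + μ + ν) * convSum lam μ ν a k (n + 1)
      + 2 * lam * convSum lam μ ν a k n = -μ * convSum lam μ ν a (k + 1) (n + 1) := by
  rw [convSum_eq_sum_range a k (le_refl (n + 2)), convSum_eq_sum_range a k (Nat.le_succ (n + 1)),
    convSum_eq_sum_range a k (show n ≤ n + 2 by omega), convSum]
  -- The extra term m = 0 on the right is harmless: g^{*0} vanishes at n + 1.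
  have : ∑ m ∈ Finset.range (n + 1), a (k + 1 + m) * convPow (g lam μ ν) (m + 1) (n + 1) =
      ∑ m ∈ Finset.range (n + 2), a (k + m) * convPow (g lam μ ν) m (n + 1) := by
    rw [Finset.sum_range_succ' _ (n + 1)]
    simp [convPow, add_comm, add_left_comm]
  rw [this, Finset.mul_sum, Finset.mul_sum, Finset.mul_sum, Finset.mul_sum,
    ← Finset.sum_sub_distrib, ← Finset.sum_add_distrib]
  refine Finset.sum_congr rfl fun m _ => ?_
  linear_combination a (k + m) * convPow_g_rec hl hμ hν m n

/-- The value at `(k, j)` of the array built from the boundary sequence `a`. -/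
def tri (lam μ ν : ℝ) (a : ℕ → ℝ) (k j : ℕ) : ℝ :=
  ν / μ * (convSum lam μ ν a k j - convSum lam μ ν a k (j + 1))

theorem tri_zero_right (hl : 0 < lam) (hμ : 0 < μ) (hν : 0 < ν) (a : ℕ → ℝ) (k : ℕ) :
    tri lam μ ν a k 0 = a k := by
  rw [tri, convSum_zero_right, convSum_one_right hl hμ hν]
  field_simp; ring

theorem tri_rec_zero (hl : 0 < lam) (hμ : 0 < μ) (hν : 0 < ν) (a : ℕ → ℝ) (k : ℕ) :
    (2 * lam + μ) * tri lam μ ν a k 0 = μ * tri lam μ ν a (k + 1) 0 + ν * tri lam μ ν a k 1 := by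
  have h := convSum_rec hl hμ hν a k 0
  simp only [tri, convSum_zero_right, zero_add, mul_zero, add_zero] at *
  linear_combination (ν / μ) * h

theorem tri_rec_succ (hl : 0 < lam) (hμ : 0 < μ) (hν : 0 < ν) (a : ℕ → ℝ) (k j : ℕ) :
    (2 * lam + μ + ν) * tri lam μ ν a k (j + 1) = μ * tri lam μ ν a (k + 1) (j + 1)
      + ν * tri lam μ ν a k (j + 2) + 2 * lam * tri lam μ ν a k j := by
  have h := convSum_rec hl hμ hν a k j
  have h' := convSum_rec hl hμ hν a k (j + 1)
  simp only [tri] at *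
  linear_combination (ν / μ) * (h' - h)

/-- Since ∑_{j≤k} `tri` (k+1) j telescopes to -(ν/μ) c(k+1, k+1), the `convSum` terms are fluxes
through the cuts max = k and max = k + 1. Their difference is the share of one triangle in the
balance at (k+1, k+1). -/
theorem tri_cut (hl : 0 < lam) (hμ : 0 < μ) (hν : 0 < ν) (a : ℕ → ℝ) (k : ℕ) :
    2 * lam * tri lam μ ν a (k + 1) k - ν * convSum lam μ ν a (k + 1) (k + 1) =
      -ν * convSum lam μ ν a (k + 2) (k + 2) - μ * tri lam μ ν a (k + 2) (k + 1)
        + ν * tri lam μ ν a (k + 1) (k + 1) := by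
  have h := convSum_rec hl hμ hν a (k + 1) k
  have e : ν / μ * μ = ν := by field_simp
  simp only [tri]
  linear_combination (ν / μ) * h
    + (convSum lam μ ν a (k + 1) (k + 1) - convSum lam μ ν a (k + 2) (k + 2)) * e

theorem convSum_eq_zero {a : ℕ → ℝ} {k : ℕ} (h : ∀ l, k ≤ l → a l = 0) (n : ℕ) :
    convSum lam μ ν a k n = 0 :=
  Finset.sum_eq_zero fun m _ => by rw [h _ (Nat.le_add_right k m), zero_mul]

theorem tri_eq_zero {a : ℕ → ℝ} {k : ℕ} (h : ∀ l, k ≤ l → a l = 0) (j : ℕ) :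
    tri lam μ ν a k j = 0 := by
  simp [tri, convSum_eq_zero h]

/-- The sequence `a`, set to zero beyond `K`. -/
def trunc (K : ℕ∞) (a : ℕ → ℝ) (l : ℕ) : ℝ := if (l : ℕ∞) ≤ K then a l else 0

theorem trunc_of_le {K : ℕ∞} {l : ℕ} (h : (l : ℕ∞) ≤ K) (a : ℕ → ℝ) : trunc K a l = a l := if_pos h

theorem trunc_of_lt {K : ℕ∞} {l : ℕ} (h : K < l) (a : ℕ → ℝ) : trunc K a l = 0 :=
  if_neg (not_le.2 h)

theorem tsum_subtype_eq_sum_range (K : ℕ∞) (f : ℕ → ℝ) (k N : ℕ) (hf : ∀ m, N ≤ m → f (k + m) = 0) :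
    ∑' l : {l : ℕ // k ≤ l ∧ (l : ℕ∞) ≤ K}, f l =
      ∑ m ∈ Finset.range N, if ((k + m : ℕ) : ℕ∞) ≤ K then f (k + m) else 0 := by
  have h := tsum_subtype {l : ℕ | k ≤ l ∧ (l : ℕ∞) ≤ K} f
  refine h.trans ?_
  rw [tsum_eq_sum (s := Finset.Ico k (k + N)), Finset.sum_Ico_eq_sum_range]
  · simp [Set.indicator_apply]
  · intro l hl
    rw [Set.indicator_apply]
    split_ifs with hk
    · obtain ⟨m, rfl⟩ := Nat.exists_eq_add_of_le hk.1
      exact hf m (by simpa using hl)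
    · rfl

theorem offDiagSum_eq_tri (K : ℕ∞) (a : ℕ → ℝ) (k j : ℕ) :
    ν / μ * offDiagSum K (g lam μ ν) a k j = tri lam μ ν (trunc K a) k j := by
  rw [offDiagSum, tri, tsum_subtype_eq_sum_range K (fun l => a l *
    (convPow (g lam μ ν) (l - k + 1) j - convPow (g lam μ ν) (l - k + 1) (j + 1))) k (j + 1),
    convSum_eq_sum_range _ k (Nat.le_succ j), convSum, ← Finset.sum_sub_distrib]
  · congr 1
    refine Finset.sum_congr rfl fun m _ => ?_
    rw [trunc, Nat.add_sub_cancel_left]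
    split_ifs <;> ring
  · intro m hm
    rw [Nat.add_sub_cancel_left, convPow_eq_zero (g_zero _ _ _) _ _ (by omega),
      convPow_eq_zero (g_zero _ _ _) _ _ (by omega), sub_zero, mul_zero]

/-- The diagonal of the array built from `a` and `b`. -/
def triDiag (lam μ₁ μ₂ : ℝ) (a b : ℕ → ℝ) (k : ℕ) : ℝ :=
  -(1 / (2 * lam)) * (μ₂ * convSum lam μ₁ μ₂ a (k + 1) (k + 1)
    + μ₁ * convSum lam μ₂ μ₁ b (k + 1) (k + 1))

theorem diagSum_eq_triDiag (K : ℕ∞) (μ₁ μ₂ : ℝ) (a b : ℕ → ℝ) (k : ℕ) :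
    diagSum K lam μ₁ μ₂ a b k = triDiag lam μ₁ μ₂ (trunc K a) (trunc K b) k := by
  rw [diagSum, triDiag, tsum_subtype_eq_sum_range K (fun l =>
    μ₂ * a l * convPow (g lam μ₁ μ₂) (l - k) (k + 1)
      + μ₁ * b l * convPow (g lam μ₂ μ₁) (l - k) (k + 1)) (k + 1) (k + 1), convSum, convSum]
  · congr 1
    rw [Finset.mul_sum, Finset.mul_sum, ← Finset.sum_add_distrib]
    refine Finset.sum_congr rfl fun m _ => ?_
    rw [trunc, trunc, show k + 1 + m - k = m + 1 by omega]
    split_ifs <;> ring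
  · intro m hm
    rw [convPow_eq_zero (g_zero _ _ _) _ _ (by omega),
      convPow_eq_zero (g_zero _ _ _) _ _ (by omega), mul_zero, mul_zero, add_zero]

theorem triDiag_comm (μ₁ μ₂ : ℝ) (a b : ℕ → ℝ) (k : ℕ) :
    triDiag lam μ₁ μ₂ a b k = triDiag lam μ₂ μ₁ b a k := by
  rw [triDiag, triDiag, add_comm]

end Algebra

/-! ### The roots of the kernel polynomials for small x -/

section Roots

variable {lam μ ν : ℝ}

theorem poly_eq (x : ℂ) : poly lam μ ν x =
    C (ν : ℂ) * X ^ 2 + C (-((2 * lam + μ + ν : ℂ) * x)) * X + C ((μ + 2 * lam * x : ℂ) * x) := by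
  rw [poly, C_neg]; ring

theorem roots_poly_iff (hν : 0 < ν) {x y z : ℂ} : (poly lam μ ν x).roots = {y, z} ↔
    ν * (y + z) = (2 * lam + μ + ν) * x ∧ ν * (y * z) = (μ + 2 * lam * x) * x := by
  rw [poly_eq, roots_quadratic_eq_pair_iff_of_ne_zero (by exact_mod_cast hν.ne')]
  constructor
  · rintro ⟨h, h'⟩
    exact ⟨by linear_combination h, by linear_combination -h'⟩
  · rintro ⟨h, h'⟩
    exact ⟨by linear_combination h, by linear_combination -h'⟩

theorem exists_roots_poly (hν : 0 < ν) (x : ℂ) : ∃ y z, (poly lam μ ν x).roots = {y, z} := by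
  rw [← Multiset.card_eq_two, IsAlgClosed.card_roots_eq_natDegree, poly_eq]
  exact natDegree_quadratic (by exact_mod_cast hν.ne')

theorem roots_poly_swap {x y z : ℂ} (h : (poly lam μ ν x).roots = {y, z}) :
    (poly lam μ ν x).roots = {z, y} := by rw [h, Multiset.pair_comm]

/-- The discriminant is x times a continuous function of x with value -4νμ ≠ 0 at x = 0. -/
theorem eventually_roots_poly_ne (hμ : 0 < μ) (hν : 0 < ν) :
    ∀ᶠ x : ℂ in 𝓝[≠] 0, ∀ y z, (poly lam μ ν x).roots = {y, z} → y ≠ z := by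
  have hc : Continuous fun x : ℂ => (2 * lam + μ + ν : ℂ) ^ 2 * x - 4 * ν * (μ + 2 * lam * x) := by
    fun_prop
  have h0 : ((2 * lam + μ + ν : ℂ) ^ 2 * 0 - 4 * ν * (μ + 2 * lam * 0)) ≠ 0 := by
    have h₁ : (μ : ℂ) ≠ 0 := by exact_mod_cast hμ.ne'
    have h₂ : (ν : ℂ) ≠ 0 := by exact_mod_cast hν.ne'
    simp [h₁, h₂]
  filter_upwards [nhdsWithin_le_nhds (hc.continuousAt.eventually_ne h0), self_mem_nhdsWithin]
    with x hx hx0 y z hr hyz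
  obtain ⟨h, h'⟩ := (roots_poly_iff hν).1 hr
  subst hyz
  refine mul_ne_zero hx hx0 ?_
  linear_combination 4 * ν * h' - (ν * (y + y) + (2 * lam + μ + ν) * x) * h

theorem eventually_roots_poly_norm_lt (hl : 0 < lam) (hμ : 0 < μ) (hν : 0 < ν) {ε : ℝ}
    (hε : 0 < ε) :
    ∀ᶠ x : ℂ in 𝓝[≠] 0, ∀ y z, (poly lam μ ν x).roots = {y, z} → ‖y‖ < ε ∧ ‖z‖ < ε := by
  -- A root satisfies ν‖y‖² ≤ ‖x‖((2λ+μ+ν)‖y‖ + μ + 2λ) once ‖x‖ < 1. The bound ‖x‖S < ν first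
  -- excludes ‖y‖ ≥ 1; then ν‖y‖² ≤ ‖x‖S < νε².
  set S := 2 * lam + μ + ν + μ + 2 * lam
  have hS : 0 < S := by positivity
  have h₁ : ∀ᶠ x : ℂ in 𝓝 0, ‖x‖ < min 1 (min (ν / S) (ν * ε ^ 2 / S)) := by
    have : Tendsto (fun x : ℂ => ‖x‖) (𝓝 0) (𝓝 0) := by
      simpa using! (continuous_norm (E := ℂ)).tendsto 0
    exact this.eventually_lt_const (by positivity)
  filter_upwards [nhdsWithin_le_nhds h₁] with x hx
  obtain ⟨hx₁, hx₂, hx₃⟩ : ‖x‖ < 1 ∧ ‖x‖ * S < ν ∧ ‖x‖ * S < ν * ε ^ 2 := by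
    rw [lt_min_iff, lt_min_iff, lt_div_iff₀ hS, lt_div_iff₀ hS] at hx
    exact hx
  have key : ∀ y z, (poly lam μ ν x).roots = {y, z} → ‖y‖ < ε := by
    intro y z hr
    obtain ⟨h, h'⟩ := (roots_poly_iff hν).1 hr
    have e : ν * y ^ 2 = x * ((2 * lam + μ + ν) * y - μ - 2 * lam * x) := by
      linear_combination y * h - h'
    have hn : ν * ‖y‖ ^ 2 ≤ ‖x‖ * ((2 * lam + μ + ν) * ‖y‖ + μ + 2 * lam) := by
      have e' := congrArg norm e
      rw [norm_mul, norm_mul, norm_pow, Complex.norm_real, Real.norm_of_nonneg hν.le] at e'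
      rw [e']
      gcongr
      have hs : ‖(2 * lam + μ + ν : ℂ)‖ = 2 * lam + μ + ν := by
        have : (2 * lam + μ + ν : ℂ) = ((2 * lam + μ + ν : ℝ) : ℂ) := by push_cast; ring
        rw [this, Complex.norm_real, Real.norm_of_nonneg (by positivity)]
      calc _ ≤ ‖(2 * lam + μ + ν : ℂ) * y‖ + ‖(μ : ℂ)‖ + ‖(2 * lam * x : ℂ)‖ :=
            (norm_sub_le _ _).trans (add_le_add_left (norm_sub_le _ _) _)
        _ ≤ _ := by
          simp only [norm_mul, hs, Complex.norm_real, Real.norm_of_nonneg hμ.le,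
            Real.norm_of_nonneg hl.le, Complex.norm_ofNat]
          nlinarith
    have hx0 := norm_nonneg x
    have hy0 := norm_nonneg y
    have hy1 : ‖y‖ < 1 := by
      by_contra hy
      push Not at hy
      have : ‖x‖ * ((2 * lam + μ + ν) * ‖y‖ + μ + 2 * lam) ≤ ‖x‖ * (S * ‖y‖) := by
        gcongr
        simp only [S]; nlinarith
      have : ν * ‖y‖ ≤ ‖x‖ * S := by
        by_contra hc
        push Not at hc
        nlinarith
      nlinarith
    have : ‖x‖ * ((2 * lam + μ + ν) * ‖y‖ + μ + 2 * lam) ≤ ‖x‖ * S := by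
      gcongr
      simp only [S]; nlinarith
    have : ‖y‖ ^ 2 < ε ^ 2 := lt_of_mul_lt_mul_left (by linarith) hν.le
    exact lt_of_pow_lt_pow_left₀ 2 hε.le this
  exact fun y z hr => ⟨key y z hr, key z y (roots_poly_swap hr)⟩

end Roots

/-! ### Generating functions along the diagonal -/

section Series

variable {lam μ ν : ℝ}

/-- The sequence grows at most geometrically. -/
def GeomBounded (a : ℕ → ℝ) : Prop := ∃ D M : ℝ, 1 ≤ M ∧ ∀ l, |a l| ≤ D * M ^ l

theorem GeomBounded.of_abs_le {a : ℕ → ℝ} {D : ℝ} (h : ∀ l, |a l| ≤ D) : GeomBounded a :=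
  ⟨D, 1, le_rfl, by simpa using h⟩

/-- The sequence `a` shifted by one place to the right. -/
def shift (a : ℕ → ℝ) : ℕ → ℝ
  | 0 => 0
  | n + 1 => a n

theorem GeomBounded.shift {a : ℕ → ℝ} (h : GeomBounded a) : GeomBounded (shift a) := by
  obtain ⟨D, M, hM, h⟩ := h
  have hD : 0 ≤ D := by simpa using (abs_nonneg _).trans (h 0)
  refine ⟨D, M, hM, fun l => ?_⟩
  cases l with
  | zero => simpa [JSQ.shift] using hD
  | succ l => exact (h l).trans (by gcongr; omega)

theorem GeomBounded.of_summable {a : ℕ → ℝ} {y : ℂ} (hy : y ≠ 0)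
    (h : Summable fun l => (a l : ℂ) * y ^ l) : GeomBounded a := by
  obtain ⟨D, hD⟩ := h.tendsto_atTop_zero.norm.bddAbove_range
  have hy' : 0 < ‖y‖ := norm_pos_iff.2 hy
  have hD0 : 0 ≤ D := (norm_nonneg _).trans (hD ⟨0, rfl⟩)
  refine ⟨D, max 1 ‖y‖⁻¹, le_max_left _ _, fun l => ?_⟩
  have := hD ⟨l, rfl⟩
  simp only [norm_mul, Complex.norm_real, Real.norm_eq_abs, norm_pow] at this
  calc |a l| ≤ D * ‖y‖⁻¹ ^ l := by
        rw [inv_pow, ← div_eq_mul_inv, le_div_iff₀ (by positivity)]; exact this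
    _ ≤ _ := by gcongr; exact le_max_right _ _

theorem GeomBounded.summable {a : ℕ → ℝ} {D M : ℝ} (hM : 1 ≤ M) (h : ∀ l, |a l| ≤ D * M ^ l)
    {y : ℂ} (hy : ‖y‖ < M⁻¹) : Summable fun l => (a l : ℂ) * y ^ l := by
  have hM0 : 0 < M := by linarith
  have hr : M * ‖y‖ < 1 := by
    calc M * ‖y‖ < M * M⁻¹ := by gcongr
      _ = 1 := mul_inv_cancel₀ hM0.ne'
  refine Summable.of_norm_bounded
    ((summable_geometric_of_lt_one (by positivity) hr).mul_left D) fun l => ?_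
  rw [norm_mul, norm_pow, Complex.norm_real, Real.norm_eq_abs, mul_pow, ← mul_assoc]
  gcongr
  exact h l

/-- The polynomials `∑_k g^{*(l-k)}(k+1) x^k` are, up to a constant, the complete homogeneous
symmetric polynomials in the two roots. -/
theorem sum_convPow_mul_pow (hl : 0 < lam) (hμ : 0 < μ) (hν : 0 < ν) {x y z : ℂ}
    (h : ν * (y + z) = (2 * lam + μ + ν) * x ∧ ν * (y * z) = (μ + 2 * lam * x) * x) (l : ℕ) :
    ν * ((y - z) * ∑ k ∈ Finset.range l, (convPow (g lam μ ν) (l - k) (k + 1) : ℂ) * x ^ k) =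
      -μ * (y ^ l - z ^ l) := by
  have hν' : (ν : ℂ) ≠ 0 := by exact_mod_cast hν.ne'
  set S : ℕ → ℂ := fun l =>
    ∑ k ∈ Finset.range l, (convPow (g lam μ ν) (l - k) (k + 1) : ℂ) * x ^ k
  -- Characteristic equation of y and z. It comes from `convPow_g_rec` termwise: all four sums are
  -- brought to the range k ≤ l with factor x^(k+1), the added or dropped terms being zero because
  -- g^{*m}(n) = 0 for n < m.
  have hrec : ∀ l, ν * S (l + 2) - (2 * lam + μ + ν) * x * S (l + 1)
      + (μ + 2 * lam * x) * x * S l = 0 := by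
    intro l
    have e₀ : S (l + 2) = ∑ k ∈ Finset.range (l + 1),
        (convPow (g lam μ ν) (l + 1 - k) (k + 2) : ℂ) * x ^ (k + 1) := by
      simp only [S]
      rw [Finset.sum_range_succ', convPow_eq_zero (g_zero _ _ _) (l + 2 - 0) (0 + 1) (by omega)]
      simp [add_assoc]
    have e₁ : x * S (l + 1) = ∑ k ∈ Finset.range (l + 1),
        (convPow (g lam μ ν) (l + 1 - k) (k + 1) : ℂ) * x ^ (k + 1) := by
      simp only [S, Finset.mul_sum]
      exact Finset.sum_congr rfl fun k _ => by ring
    have e₂ : x * S l = ∑ k ∈ Finset.range (l + 1),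
        (convPow (g lam μ ν) (l - k) (k + 1) : ℂ) * x ^ (k + 1) := by
      simp only [S, Finset.mul_sum]
      rw [Finset.sum_range_succ]
      simp only [Nat.sub_self, convPow, Nat.succ_ne_zero, if_false, Complex.ofReal_zero, zero_mul,
        add_zero]
      exact Finset.sum_congr rfl fun k _ => by ring
    have e₃ : x * x * S l = ∑ k ∈ Finset.range (l + 1),
        (convPow (g lam μ ν) (l + 1 - k) k : ℂ) * x ^ (k + 1) := by
      simp only [S, Finset.mul_sum]
      rw [Finset.sum_range_succ', convPow_eq_zero (g_zero _ _ _) (l + 1 - 0) 0 (by omega)]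
      simp only [Complex.ofReal_zero, zero_mul, add_zero]
      exact Finset.sum_congr rfl fun k _ => by rw [Nat.add_sub_add_right]; ring
    have key : ν * S (l + 2) - (2 * lam + μ + ν) * (x * S (l + 1)) + 2 * lam * (x * x * S l)
        + μ * (x * S l) = 0 := by
      rw [e₀, e₁, e₂, e₃]
      simp only [Finset.mul_sum]
      rw [← Finset.sum_sub_distrib, ← Finset.sum_add_distrib, ← Finset.sum_add_distrib]
      refine Finset.sum_eq_zero fun k hk => ?_
      obtain ⟨m, hm⟩ : ∃ m, l - k = m := ⟨_, rfl⟩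
      have hk' := Finset.mem_range.1 hk
      have r := congrArg (fun t : ℝ => (t : ℂ)) (convPow_g_rec hl hμ hν m k)
      push_cast at r
      rw [show l + 1 - k = m + 1 by omega, hm]
      linear_combination x ^ (k + 1) * r
    linear_combination key
  have both : ∀ l, ν * ((y - z) * S l) = -μ * (y ^ l - z ^ l) ∧
      ν * ((y - z) * S (l + 1)) = -μ * (y ^ (l + 1) - z ^ (l + 1)) := by
    intro l
    induction l with
    | zero =>
      have : (ν : ℂ) * (μ / ν) = μ := by field_simp
      refine ⟨by simp [S], ?_⟩
      simp only [S, zero_add, Finset.sum_range_one, Nat.sub_zero, convPow_one, g_one hl hμ hν,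
        Complex.ofReal_neg, Complex.ofReal_div, pow_zero, pow_one, mul_one]
      linear_combination -(y - z) * this
    | succ l ih =>
      refine ⟨ih.2, mul_left_cancel₀ hν' ?_⟩
      linear_combination (ν * (y - z)) * hrec l + ν * (y + z) * ih.2 - ν * (y * z) * ih.1
        - ν * (y - z) * S (l + 1) * h.1 + ν * (y - z) * S l * h.2
  exact (both l).1

theorem hasSum_convSum_term (a : ℕ → ℝ) (k : ℕ) (x : ℂ) :
    HasSum (fun l => if k < l then (a l : ℂ) * convPow (g lam μ ν) (l - k) (k + 1) * x ^ k else 0)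
      (convSum lam μ ν a (k + 1) (k + 1) * x ^ k) := by
  have : (convSum lam μ ν a (k + 1) (k + 1) * x ^ k : ℂ) =
      ∑ l ∈ Finset.Ico (k + 1) (k + 1 + (k + 1)),
        if k < l then (a l : ℂ) * convPow (g lam μ ν) (l - k) (k + 1) * x ^ k else 0 := by
    rw [Finset.sum_Ico_eq_sum_range, convSum, Complex.ofReal_sum, Finset.sum_mul,
      Nat.add_sub_cancel_left]
    refine Finset.sum_congr rfl fun m _ => ?_
    rw [if_pos (by omega), show k + 1 + m - k = m + 1 by omega]
    push_cast; ring
  rw [this]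
  refine hasSum_sum_of_ne_finset_zero fun l hl => ?_
  split_ifs with hk
  · rw [convPow_eq_zero (g_zero _ _ _) _ _ (by simp at hl; omega)]; simp
  · rfl

/-- The generating function of the diagonal sums. -/
theorem eventually_hasSum_convSum (hl : 0 < lam) (hμ : 0 < μ) (hν : 0 < ν) {a : ℕ → ℝ}
    (ha : GeomBounded a) :
    ∀ᶠ x : ℂ in 𝓝[≠] 0, ∀ y z, (poly lam μ ν x).roots = {y, z} →
      y ≠ z ∧ (Summable fun l => (a l : ℂ) * y ^ l) ∧ (Summable fun l => (a l : ℂ) * z ^ l) ∧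
      HasSum (fun k => (convSum lam μ ν a (k + 1) (k + 1) : ℂ) * x ^ k)
        (-(μ / ν) * ((∑' l, (a l : ℂ) * y ^ l - ∑' l, (a l : ℂ) * z ^ l) / (y - z))) := by
  obtain ⟨D, M, hM, ha⟩ := ha
  obtain ⟨B, hB, hΓ⟩ := exists_abs_convPow_g_le (μ := μ) (ν := ν) hl hμ hν
  have hM0 : 0 < M := by linarith
  have hB0 : 0 < B := by linarith
  have hD0 : 0 ≤ D := by simpa using (abs_nonneg _).trans (ha 0)
  have hx : ∀ᶠ x : ℂ in 𝓝 0, (2 * M) ^ 2 * (B * ‖x‖) < 1 := by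
    have : Tendsto (fun x : ℂ => (2 * M) ^ 2 * (B * ‖x‖)) (𝓝 0) (𝓝 0) := by
      have hc : Continuous fun x : ℂ => (2 * M) ^ 2 * (B * ‖x‖) := by fun_prop
      simpa using! hc.tendsto 0
    exact this.eventually_lt_const one_pos
  filter_upwards [nhdsWithin_le_nhds hx, eventually_roots_poly_ne hμ hν,
    eventually_roots_poly_norm_lt hl hμ hν (inv_pos.2 hM0)] with x hx hne hlt y z hr
  obtain ⟨hy, hz⟩ := hlt y z hr
  have hyz := hne y z hr
  have hsy := GeomBounded.summable hM ha hy
  have hsz := GeomBounded.summable hM ha hz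
  refine ⟨hyz, hsy, hsz, ?_⟩
  have hr' := (roots_poly_iff hν).1 hr
  have hν' : (ν : ℂ) ≠ 0 := by exact_mod_cast hν.ne'
  have hyz' : y - z ≠ 0 := sub_ne_zero.2 hyz
  set F : ℕ × ℕ → ℂ := fun p => if p.1 < p.2 then
    (a p.2 : ℂ) * convPow (g lam μ ν) (p.2 - p.1) (p.1 + 1) * x ^ p.1 else 0
  -- Nonzero terms have k < l ≤ 2k + 1. Inserting 2^l · 2^(-l) and estimating (2M)^l ≤ (2M)^(2k+1)
  -- dominates them by a product of geometric sequences in k and l; this is where (2M)²B‖x‖ < 1 is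
  -- needed.
  have hF : Summable F := by
    have hg : Summable fun p : ℕ × ℕ => (D * B * (2 * M)) *
        (((2 * M) ^ 2 * (B * ‖x‖)) ^ p.1 * (1 / 2 : ℝ) ^ p.2) :=
      ((summable_geometric_of_lt_one (by positivity) hx).mul_of_nonneg
        (summable_geometric_of_lt_one (by norm_num) (by norm_num)) (fun _ => by positivity)
        fun _ => by positivity).mul_left _
    refine Summable.of_norm_bounded hg fun ⟨k, l⟩ => ?_
    simp only [F]
    split_ifs with hkl
    · rcases Nat.lt_or_ge (k + 1) (l - k) with h | h
      · rw [convPow_eq_zero (g_zero _ _ _) _ _ h]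
        simp only [Complex.ofReal_zero, mul_zero, zero_mul, norm_zero]
        positivity
      · rw [norm_mul, norm_mul, norm_pow, Complex.norm_real, Complex.norm_real, Real.norm_eq_abs,
          Real.norm_eq_abs]
        have h2 : (2 * M) ^ l ≤ (2 * M) ^ (2 * k + 1) :=
          pow_le_pow_right₀ (by linarith) (by omega)
        calc _ ≤ (D * M ^ l) * B ^ (k + 1) * ‖x‖ ^ k := by
              gcongr
              · exact ha l
              · exact hΓ _ _
          _ = (D * B * (B * ‖x‖) ^ k * (1 / 2 : ℝ) ^ l) * (2 * M) ^ l := by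
              have : (1 / 2 : ℝ) ^ l * 2 ^ l = 1 := by rw [← mul_pow]; norm_num
              rw [mul_pow 2 M, mul_pow B, pow_succ]
              linear_combination -(D * M ^ l * B ^ k * B * ‖x‖ ^ k) * this
          _ ≤ (D * B * (B * ‖x‖) ^ k * (1 / 2 : ℝ) ^ l) * (2 * M) ^ (2 * k + 1) := by gcongr
          _ = _ := by rw [mul_pow ((2 * M) ^ 2), ← pow_mul, pow_succ]; ring
    · rw [norm_zero]; positivity
  -- The two orders of summation: over l first this is the diagonal series, over k first it is
  -- `sum_convPow_mul_pow`.
  have h₁ : HasSum (fun k => (convSum lam μ ν a (k + 1) (k + 1) : ℂ) * x ^ k) (∑' p, F p) :=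
    hF.hasSum.prod_fiberwise fun k => hasSum_convSum_term a k x
  have h₂ : HasSum (fun l => -(μ / ν) * (((a l : ℂ) * y ^ l - (a l : ℂ) * z ^ l) / (y - z)))
      (∑' p, F p) := by
    have hF' : HasSum (F ∘ Prod.swap) (∑' p, F p) :=
      ((Equiv.prodComm ℕ ℕ).hasSum_iff).2 hF.hasSum
    refine hF'.prod_fiberwise fun l => ?_
    have e : -(μ / ν) * (((a l : ℂ) * y ^ l - (a l : ℂ) * z ^ l) / (y - z)) =
        ∑ k ∈ Finset.range l, F (k, l) := by
      have hs := sum_convPow_mul_pow hl hμ hν hr' l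
      have : ∑ k ∈ Finset.range l, F (k, l) = a l *
          ∑ k ∈ Finset.range l, (convPow (g lam μ ν) (l - k) (k + 1) : ℂ) * x ^ k := by
        rw [Finset.mul_sum]
        refine Finset.sum_congr rfl fun k hk => ?_
        simp only [F]
        rw [if_pos (Finset.mem_range.1 hk), mul_assoc]
      rw [this]
      field_simp
      linear_combination -(a l : ℂ) * hs
    rw [e]
    refine hasSum_sum_of_ne_finset_zero fun k hk => ?_
    simp only [Function.comp, F, Prod.swap]
    rw [if_neg (by simpa using hk)]
  have h₃ := (((hsy.hasSum.sub hsz.hasSum).div_const (y - z)).mul_left (-(μ / ν) : ℂ)).unique h₂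
  rw [h₃]
  exact h₁

/-- Puts c(k, k+1), which occurs in `tri` k k, into the diagonal form covered by
`eventually_hasSum_convSum`. Shifting a multiplies its generating function by y, whence the factors
y - x and z - x below. -/
theorem convSum_shift (a : ℕ → ℝ) (k n : ℕ) :
    convSum lam μ ν (shift a) (k + 1) n = convSum lam μ ν a k n :=
  Finset.sum_congr rfl fun m _ => by rw [Nat.succ_add k m]; rfl

theorem tri_diag_zero (a : ℕ → ℝ) :
    tri lam μ ν a 0 0 = -(ν / μ) * convSum lam μ ν (shift a) 1 1 := by
  rw [tri, convSum_zero_right, convSum_shift]; ring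

theorem tri_diag_succ (a : ℕ → ℝ) (k : ℕ) : tri lam μ ν a (k + 1) (k + 1) =
    ν / μ * convSum lam μ ν a (k + 1) (k + 1)
      - ν / μ * convSum lam μ ν (shift a) (k + 2) (k + 2) := by
  rw [tri, convSum_shift]; ring

theorem hasSum_pow_shift {f : ℕ → ℝ} {x s : ℂ} (h : HasSum (fun k => (f k : ℂ) * x ^ k) s) :
    HasSum (fun k => (shift f k : ℂ) * x ^ k) (x * s) := by
  rw [← hasSum_nat_add_iff' 1]
  simp only [Finset.sum_range_one, shift, Complex.ofReal_zero, zero_mul, sub_zero]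
  exact (h.mul_left x).congr_fun fun k => by ring

/-- The generating function of the diagonal of the array `tri`. -/
theorem eventually_hasSum_tri (hl : 0 < lam) (hμ : 0 < μ) (hν : 0 < ν) {a : ℕ → ℝ}
    (ha : GeomBounded a) :
    ∀ᶠ x : ℂ in 𝓝[≠] 0, ∀ y z, (poly lam μ ν x).roots = {y, z} →
      HasSum (fun k => (tri lam μ ν a k k : ℂ) * x ^ k)
        (((y - x) * (∑' l, (a l : ℂ) * y ^ l) - (z - x) * ∑' l, (a l : ℂ) * z ^ l) / (y - z)) := by
  filter_upwards [eventually_hasSum_convSum hl hμ hν ha,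
    eventually_hasSum_convSum hl hμ hν ha.shift]
    with x h h' y z hr
  obtain ⟨hyz, hsy, hsz, hc⟩ := h y z hr
  obtain ⟨-, -, -, hc'⟩ := h' y z hr
  have hshift : ∀ w : ℂ, (Summable fun l => (a l : ℂ) * w ^ l) →
      ∑' l, (shift a l : ℂ) * w ^ l = w * ∑' l, (a l : ℂ) * w ^ l :=
    fun w hw => (hasSum_pow_shift hw.hasSum).tsum_eq
  rw [hshift y hsy, hshift z hsz] at hc'
  have hμ' : (μ : ℂ) ≠ 0 := by exact_mod_cast hμ.ne'
  have hν' : (ν : ℂ) ≠ 0 := by exact_mod_cast hν.ne'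
  have hyz' : y - z ≠ 0 := sub_ne_zero.2 hyz
  have := ((hasSum_pow_shift hc).sub hc').mul_left (ν / μ : ℂ)
  have e : ((y - x) * (∑' l, (a l : ℂ) * y ^ l) - (z - x) * ∑' l, (a l : ℂ) * z ^ l) / (y - z) =
      ν / μ * (x * (-(μ / ν) *
          ((∑' l, (a l : ℂ) * y ^ l - ∑' l, (a l : ℂ) * z ^ l) / (y - z))) -
        -(μ / ν) * ((y * ∑' l, (a l : ℂ) * y ^ l - z * ∑' l, (a l : ℂ) * z ^ l) / (y - z))) := by
    field_simp; ring
  rw [e]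
  refine this.congr_fun fun k => ?_
  cases k with
  | zero => rw [tri_diag_zero]; simp [shift]
  | succ k => rw [tri_diag_succ]; simp only [shift]; push_cast; ring

/-- A power series vanishing near the centre has zero coefficients. -/
theorem eq_zero_of_eventually_hasSum {R : ℕ → ℂ}
    (h : ∀ᶠ x : ℂ in 𝓝[≠] 0, HasSum (fun k => R k * x ^ k) 0) (k : ℕ) : R k = 0 := by
  -- The hypothesis says nothing at x = 0, where the series has the sum R 0. The function is set to
  -- that value there, and continuity then forces R 0 = 0.
  set f : ℂ → ℂ := Function.update (fun _ => 0) 0 (R 0)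
  have hf : HasFPowerSeriesAt f (FormalMultilinearSeries.ofScalars ℂ R) 0 := by
    rw [hasFPowerSeriesAt_iff]
    rw [eventually_nhdsWithin_iff] at h
    filter_upwards [h] with x hx
    simp only [FormalMultilinearSeries.coeff_ofScalars, zero_add, smul_eq_mul]
    by_cases hx0 : x = 0
    · subst hx0
      rw [show f 0 = R 0 from Function.update_self _ _ _]
      have := hasSum_single (f := fun n => (0 : ℂ) ^ n * R n) 0 fun n hn => by simp [hn]
      rwa [pow_zero, one_mul] at this
    · rw [show f x = 0 from Function.update_of_ne hx0 _ _]
      exact (hx hx0).congr_fun fun k => mul_comm _ _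
  have hf0 : f 0 = 0 := by
    have h₁ : Tendsto f (𝓝[≠] 0) (𝓝 (f 0)) := hf.continuousAt.tendsto.mono_left nhdsWithin_le_nhds
    have h₂ : Tendsto f (𝓝[≠] 0) (𝓝 0) := by
      refine tendsto_const_nhds.congr' ?_
      filter_upwards [self_mem_nhdsWithin] with x hx
      exact (Function.update_of_ne (f := fun _ : ℂ => (0 : ℂ)) hx _).symm
    exact tendsto_nhds_unique h₁ h₂
  have hz : f =ᶠ[𝓝 0] 0 := Eventually.of_forall fun x => by
    by_cases hx0 : x = 0
    · rw [hx0]; exact hf0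
    · exact Function.update_of_ne hx0 _ _
  rw [← FormalMultilinearSeries.coeff_ofScalars (p := R) (n := k), hf.eq_zero_of_eventually hz]
  rfl

end Series

/-! ### Balance equations and uniqueness of summable solutions -/

section Balance

/-- The rate of arrivals at a queue of length `i` when the other queue has length `j` and ties
are broken with probability `p`. -/
def arr (K : ℕ∞) (lam p : ℝ) (i j : ℕ) : ℝ :=
  if i < j then 2 * lam else if i = j ∧ (i : ℕ∞) < K then 2 * lam * p else 0

/-- The total jump rate out of `v`. -/
def outRate (K : ℕ∞) (lam μ₁ μ₂ p₁ p₂ : ℝ) (v : ℕ × ℕ) : ℝ :=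
  arr K lam p₁ v.1 v.2 + arr K lam p₂ v.2 v.1 + shift (fun _ => μ₁) v.1 + shift (fun _ => μ₂) v.2

/-- The inflow into `w` from the measure `h`. -/
def inflow (K : ℕ∞) (lam μ₁ μ₂ p₁ p₂ : ℝ) (h : ℕ × ℕ → ℝ) (w : ℕ × ℕ) : ℝ :=
  shift (fun i => h (i, w.2) * arr K lam p₁ i w.2) w.1
    + shift (fun j => h (w.1, j) * arr K lam p₂ j w.1) w.2
    + μ₁ * h (w.1 + 1, w.2) + μ₂ * h (w.1, w.2 + 1)

/-- The balance equations in explicit form. -/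
def Balanced (K : ℕ∞) (lam μ₁ μ₂ p₁ p₂ : ℝ) (h : ℕ × ℕ → ℝ) : Prop :=
  ∀ w, h w * outRate K lam μ₁ μ₂ p₁ p₂ w = inflow K lam μ₁ μ₂ p₁ p₂ h w

variable {K : ℕ∞} {lam μ₁ μ₂ p₁ p₂ : ℝ} {h : ℕ × ℕ → ℝ}

theorem rate_eq (v w : ℕ × ℕ) : rate K lam μ₁ μ₂ p₁ p₂ v w =
    (if w = (v.1 + 1, v.2) then arr K lam p₁ v.1 v.2 else 0)
      + (if w = (v.1, v.2 + 1) then arr K lam p₂ v.2 v.1 else 0)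
      + (if v = (w.1 + 1, w.2) then μ₁ else 0) + (if v = (w.1, w.2 + 1) then μ₂ else 0) := by
  have e : ((v.1 = v.2 ∧ (v.1 : ℕ∞) < K) ↔ (v.2 = v.1 ∧ (v.2 : ℕ∞) < K)) := by
    constructor
    · rintro ⟨h, h'⟩; exact ⟨h.symm, h ▸ h'⟩
    · rintro ⟨h, h'⟩; exact ⟨h.symm, h ▸ h'⟩
  simp only [rate, arr, e]

theorem hasSum_inflow (w : ℕ × ℕ) : HasSum (fun v => h v * rate K lam μ₁ μ₂ p₁ p₂ v w)
    (inflow K lam μ₁ μ₂ p₁ p₂ h w) := by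
  obtain ⟨i, j⟩ := w
  simp only [rate_eq, mul_add, inflow]
  refine ((HasSum.add (HasSum.add ?_ ?_) ?_).add ?_)
  · cases i with
    | zero => exact hasSum_zero.congr_fun fun v => by simp
    | succ i =>
      convert hasSum_single (f := fun v : ℕ × ℕ =>
        h v * if (i + 1, j) = (v.1 + 1, v.2) then arr K lam p₁ v.1 v.2 else 0) (i, j)
        fun v hv => ?_ using 1
      · simp [shift]
      · rw [if_neg, mul_zero]
        rintro ⟨⟩; exact hv rfl
  · cases j with
    | zero => exact hasSum_zero.congr_fun fun v => by simp
    | succ j =>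
      convert hasSum_single (f := fun v : ℕ × ℕ =>
        h v * if (i, j + 1) = (v.1, v.2 + 1) then arr K lam p₂ v.2 v.1 else 0) (i, j)
        fun v hv => ?_ using 1
      · simp [shift]
      · rw [if_neg, mul_zero]
        rintro ⟨⟩; exact hv rfl
  · convert hasSum_single (f := fun v : ℕ × ℕ => h v * if v = (i + 1, j) then μ₁ else 0) (i + 1, j)
      fun v hv => ?_ using 1
    · simp [mul_comm]
    · rw [if_neg hv, mul_zero]
  · convert hasSum_single (f := fun v : ℕ × ℕ => h v * if v = (i, j + 1) then μ₂ else 0) (i, j + 1)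
      fun v hv => ?_ using 1
    · simp [mul_comm]
    · rw [if_neg hv, mul_zero]

theorem tsum_rate (v : ℕ × ℕ) :
    ∑' w, rate K lam μ₁ μ₂ p₁ p₂ v w = outRate K lam μ₁ μ₂ p₁ p₂ v := by
  obtain ⟨i, j⟩ := v
  refine (HasSum.congr_fun ?_ fun w => rate_eq (i, j) w).tsum_eq
  simp only [outRate]
  refine ((HasSum.add (HasSum.add ?_ ?_) ?_).add ?_)
  · exact hasSum_ite_eq _ _
  · exact hasSum_ite_eq _ _
  · cases i with
    | zero => exact hasSum_zero.congr_fun fun v => by simp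
    | succ i =>
      refine (hasSum_ite_eq (i, j) μ₁).congr_fun fun w => if_congr ?_ rfl rfl
      obtain ⟨w₁, w₂⟩ := w
      simp only [Prod.mk.injEq]; omega
  · cases j with
    | zero => exact hasSum_zero.congr_fun fun v => by simp
    | succ j =>
      refine (hasSum_ite_eq (i, j) μ₂).congr_fun fun w => if_congr ?_ rfl rfl
      obtain ⟨w₁, w₂⟩ := w
      simp only [Prod.mk.injEq]; omega

theorem IsStationary.balanced (hs : IsStationary K lam μ₁ μ₂ p₁ p₂ h) :
    Balanced K lam μ₁ μ₂ p₁ p₂ h := fun w => by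
  rw [← tsum_rate]
  exact (hs.balance w).unique (hasSum_inflow w)

theorem Balanced.swap (hb : Balanced K lam μ₁ μ₂ p₁ p₂ h) :
    Balanced K lam μ₂ μ₁ p₂ p₁ fun v => h (v.2, v.1) := fun w => by
  have := hb (w.2, w.1)
  simp only [outRate, inflow] at this ⊢
  linear_combination this

theorem Balanced.sub_smul {h' : ℕ × ℕ → ℝ} (hb : Balanced K lam μ₁ μ₂ p₁ p₂ h)
    (hb' : Balanced K lam μ₁ μ₂ p₁ p₂ h') (c : ℝ) :
    Balanced K lam μ₁ μ₂ p₁ p₂ fun v => h v - c * h' v := by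
  rintro ⟨i, j⟩
  have e := hb (i, j)
  have e' := hb' (i, j)
  cases i <;> cases j <;> simp only [inflow, shift] at e e' ⊢ <;> linear_combination e - c * e'

theorem arr_nonneg (hl : 0 < lam) {p : ℝ} (hp : 0 ≤ p) (i j : ℕ) : 0 ≤ arr K lam p i j := by
  unfold arr; split_ifs <;> positivity

theorem arr_le (hl : 0 < lam) {p : ℝ} (hp : p ≤ 1) (i j : ℕ) : arr K lam p i j ≤ 2 * lam := by
  unfold arr; split_ifs <;> nlinarith

theorem arr_of_lt {p : ℝ} {i j : ℕ} (hij : i < j) : arr K lam p i j = 2 * lam := if_pos hij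

theorem arr_of_gt {p : ℝ} {i j : ℕ} (hij : j < i) : arr K lam p i j = 0 := by
  rw [arr, if_neg (by omega), if_neg (by omega)]

/-- The expected rate of change, without the loss term, of `f` at `v`. -/
def gain (K : ℕ∞) (lam μ₁ μ₂ p₁ p₂ : ℝ) (f : ℕ × ℕ → ℝ) (v : ℕ × ℕ) : ℝ :=
  arr K lam p₁ v.1 v.2 * f (v.1 + 1, v.2) + arr K lam p₂ v.2 v.1 * f (v.1, v.2 + 1)
    + shift (fun i => μ₁ * f (i, v.2)) v.1 + shift (fun j => μ₂ * f (v.1, j)) v.2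

theorem summable_mul_of_abs_le {ι : Type*} {h φ : ι → ℝ} (hs : Summable h) {B : ℝ}
    (hφ : ∀ v, |φ v| ≤ B) : Summable fun v => h v * φ v := by
  refine Summable.of_norm_bounded (hs.abs.mul_right B) fun v => ?_
  rw [Real.norm_eq_abs, abs_mul]
  gcongr
  exact hφ v

theorem abs_arr_mul_le (hl : 0 < lam) {p : ℝ} (hp : 0 ≤ p) (hp' : p ≤ 1) {t B : ℝ} (ht : |t| ≤ B)
    (i j : ℕ) : |arr K lam p i j * t| ≤ 2 * lam * B := by
  rw [abs_mul, abs_of_nonneg (arr_nonneg hl hp i j)]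
  exact mul_le_mul (arr_le hl hp' i j) ht (abs_nonneg _) (by positivity)

/-- Integrating the inflow against a bounded function. -/
theorem exists_hasSum_inflow (hl : 0 < lam) (hp₁ : 0 ≤ p₁) (hp₁' : p₁ ≤ 1) (hp₂ : 0 ≤ p₂)
    (hp₂' : p₂ ≤ 1) (hs : Summable h) {f : ℕ × ℕ → ℝ} {B : ℝ} (hf : ∀ v, |f v| ≤ B) :
    ∃ s, HasSum (fun w => f w * inflow K lam μ₁ μ₂ p₁ p₂ h w) s ∧
      HasSum (fun v => h v * gain K lam μ₁ μ₂ p₁ p₂ f v) s := by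
  -- Each of the four jump types is reindexed along one of these translations; outside the range,
  -- the `shift` factor is zero.
  have i₁ : Function.Injective fun v : ℕ × ℕ => (v.1 + 1, v.2) := by
    rintro ⟨a, b⟩ ⟨c, d⟩ e; simp at e; simp [e]
  have i₂ : Function.Injective fun v : ℕ × ℕ => (v.1, v.2 + 1) := by
    rintro ⟨a, b⟩ ⟨c, d⟩ e; simp at e; simp [e]
  have h₁ := (summable_mul_of_abs_le (φ := fun v : ℕ × ℕ => arr K lam p₁ v.1 v.2 * f (v.1 + 1, v.2))
    hs fun v => abs_arr_mul_le hl hp₁ hp₁' (hf _) _ _).hasSum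
  have h₂ := (summable_mul_of_abs_le (φ := fun v : ℕ × ℕ => arr K lam p₂ v.2 v.1 * f (v.1, v.2 + 1))
    hs fun v => abs_arr_mul_le hl hp₂ hp₂' (hf _) _ _).hasSum
  have h₃ := ((summable_mul_of_abs_le (hs.comp_injective i₁) hf).mul_left μ₁).hasSum
  have h₄ := ((summable_mul_of_abs_le (hs.comp_injective i₂) hf).mul_left μ₂).hasSum
  have h₁' := (i₁.hasSum_iff (f := fun w : ℕ × ℕ =>
      f w * shift (fun i => h (i, w.2) * arr K lam p₁ i w.2) w.1) (by
    rintro ⟨i, j⟩ hw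
    cases i with
    | zero => simp [shift]
    | succ i => exact absurd ⟨(i, j), rfl⟩ hw)).1 (h₁.congr_fun fun v => by
      simp only [Function.comp, shift]; ring)
  have h₂' := (i₂.hasSum_iff (f := fun w : ℕ × ℕ =>
      f w * shift (fun j => h (w.1, j) * arr K lam p₂ j w.1) w.2) (by
    rintro ⟨i, j⟩ hw
    cases j with
    | zero => simp [shift]
    | succ j => exact absurd ⟨(i, j), rfl⟩ hw)).1 (h₂.congr_fun fun v => by
      simp only [Function.comp, shift]; ring)
  have h₃' := (i₁.hasSum_iff (f := fun w : ℕ × ℕ =>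
      h w * shift (fun i => μ₁ * f (i, w.2)) w.1) (by
    rintro ⟨i, j⟩ hw
    cases i with
    | zero => simp [shift]
    | succ i => exact absurd ⟨(i, j), rfl⟩ hw)).1 (h₃.congr_fun fun v => by
      simp only [Function.comp, shift]; ring)
  have h₄' := (i₂.hasSum_iff (f := fun w : ℕ × ℕ =>
      h w * shift (fun j => μ₂ * f (w.1, j)) w.2) (by
    rintro ⟨i, j⟩ hw
    cases j with
    | zero => simp [shift]
    | succ j => exact absurd ⟨(i, j), rfl⟩ hw)).1 (h₄.congr_fun fun v => by
      simp only [Function.comp, shift]; ring)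
  refine ⟨_, (((h₁'.add h₂').add h₃).add h₄).congr_fun fun w => ?_,
    (((h₁.add h₂).add h₃').add h₄').congr_fun fun v => ?_⟩
  · simp only [inflow, Function.comp]; ring
  · simp only [gain]; ring

theorem shift_nonneg {f : ℕ → ℝ} (hf : ∀ n, 0 ≤ f n) (n : ℕ) : 0 ≤ shift f n := by
  cases n with
  | zero => exact le_rfl
  | succ n => exact hf n

/-- A summable solution of the balance equations vanishing at the origin vanishes. -/
theorem Balanced.eq_zero (hl : 0 < lam) (hμ₁ : 0 < μ₁) (hμ₂ : 0 < μ₂) (hp₁ : 0 ≤ p₁)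
    (hp₁' : p₁ ≤ 1) (hp₂ : 0 ≤ p₂) (hp₂' : p₂ ≤ 1) (hb : Balanced K lam μ₁ μ₂ p₁ p₂ h)
    (hs : Summable h) (h0 : h (0, 0) = 0) (v : ℕ × ℕ) : h v = 0 := by
  set H : ℕ × ℕ → ℝ := fun v => |h v|
  have hout : ∀ v, 0 ≤ outRate K lam μ₁ μ₂ p₁ p₂ v := fun v =>
    add_nonneg (add_nonneg (add_nonneg (arr_nonneg hl hp₁ _ _) (arr_nonneg hl hp₂ _ _))
      (shift_nonneg (fun _ => hμ₁.le) _)) (shift_nonneg (fun _ => hμ₂.le) _)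
  obtain ⟨s, hs₁, hs₂⟩ := exists_hasSum_inflow (K := K) (μ₁ := μ₁) (μ₂ := μ₂) (h := H)
    (f := fun _ => 1) (B := 1) hl hp₁ hp₁' hp₂ hp₂' hs.abs (by simp)
  have hgain : gain K lam μ₁ μ₂ p₁ p₂ (fun _ => 1) = outRate K lam μ₁ μ₂ p₁ p₂ := by
    funext v; simp [gain, outRate]
  rw [hgain] at hs₂
  have habs : ∀ (f : ℕ → ℝ) n, |shift f n| = shift (fun k => |f k|) n := fun f n => by
    cases n <;> simp [shift]
  -- Triangle inequality in the balance equation. Total inflow and total outflow of H agree, so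
  -- equality holds at every state.
  have hle : ∀ w, H w * outRate K lam μ₁ μ₂ p₁ p₂ w ≤ inflow K lam μ₁ μ₂ p₁ p₂ H w := fun w => by
    have e := congrArg abs (hb w)
    rw [abs_mul, abs_of_nonneg (hout w)] at e
    rw [e, inflow, inflow]
    refine (abs_add_le _ _).trans (add_le_add ((abs_add_le _ _).trans (add_le_add
      ((abs_add_le _ _).trans (add_le_add ?_ ?_)) ?_)) ?_)
    · simp only [habs, abs_mul, abs_of_nonneg (arr_nonneg hl hp₁ _ _), H, le_refl]
    · simp only [habs, abs_mul, abs_of_nonneg (arr_nonneg hl hp₂ _ _), H, le_refl]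
    · rw [abs_mul, abs_of_pos hμ₁]
    · rw [abs_mul, abs_of_pos hμ₂]
  have heq : ∀ w, H w * outRate K lam μ₁ μ₂ p₁ p₂ w = inflow K lam μ₁ μ₂ p₁ p₂ H w := fun w => by
    have hd := hs₁.sub hs₂
    rw [sub_self, hasSum_zero_iff_of_nonneg fun w => by
      simpa using sub_nonneg.2 (hle w)] at hd
    have := congrFun hd w
    simp only [one_mul, Pi.zero_apply] at this
    linarith
  -- At a zero of H all inflow terms are nonnegative with sum zero. The services at (i+1, j) and (i,
  -- j+1) have positive rates, so H vanishes there too.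
  have step : ∀ i j, H (i, j) = 0 → H (i + 1, j) = 0 ∧ H (i, j + 1) = 0 := fun i j hij => by
    have e := heq (i, j)
    rw [hij, zero_mul, inflow] at e
    have n₁ : 0 ≤ shift (fun i' => H (i', j) * arr K lam p₁ i' j) i :=
      shift_nonneg (fun _ => mul_nonneg (abs_nonneg _) (arr_nonneg hl hp₁ _ _)) _
    have n₂ : 0 ≤ shift (fun j' => H (i, j') * arr K lam p₂ j' i) j :=
      shift_nonneg (fun _ => mul_nonneg (abs_nonneg _) (arr_nonneg hl hp₂ _ _)) _
    have n₃ : 0 ≤ μ₁ * H (i + 1, j) := mul_nonneg hμ₁.le (abs_nonneg _)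
    have n₄ : 0 ≤ μ₂ * H (i, j + 1) := mul_nonneg hμ₂.le (abs_nonneg _)
    simp only at e
    constructor
    · exact (mul_eq_zero.1 (by linarith : μ₁ * H (i + 1, j) = 0)).resolve_left hμ₁.ne'
    · exact (mul_eq_zero.1 (by linarith : μ₂ * H (i, j + 1) = 0)).resolve_left hμ₂.ne'
  have col : ∀ i, H (i, 0) = 0 := fun i => by
    induction i with
    | zero => simp [H, h0]
    | succ i ih => exact (step i 0 ih).1
  have all : ∀ i j, H (i, j) = 0 := fun i j => by
    induction j with
    | zero => exact col i
    | succ j ih => exact (step i j ih).2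
  exact abs_eq_zero.1 (all v.1 v.2)

end Balance

/-! ### From boundary values to solutions of the balance equations and back -/

section Triangle

variable {K : ℕ∞} {lam μ₁ μ₂ p₁ p₂ : ℝ} {h : ℕ × ℕ → ℝ}

/-- `1` below the capacity and `0` at or above it. -/
def below (K : ℕ∞) (k : ℕ) : ℝ := if (k : ℕ∞) < K then 1 else 0

theorem arr_self (p : ℝ) (k : ℕ) : arr K lam p k k = 2 * lam * p * below K k := by
  simp [arr, below]

theorem Balanced.lower_zero (hb : Balanced K lam μ₁ μ₂ p₁ p₂ h) (k : ℕ) :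
    (2 * lam + μ₁) * h (k + 1, 0) =
      h (k, 0) * arr K lam p₁ k 0 + μ₁ * h (k + 2, 0) + μ₂ * h (k + 1, 1) := by
  have := hb (k + 1, 0)
  simp only [outRate, inflow, shift, arr_of_lt (Nat.succ_pos k), arr_of_gt (Nat.succ_pos k)] at this
  linear_combination this

theorem Balanced.lower_succ (hb : Balanced K lam μ₁ μ₂ p₁ p₂ h) {k j : ℕ} (hj : j < k) :
    (2 * lam + μ₁ + μ₂) * h (k + 1, j + 1) = h (k, j + 1) * arr K lam p₁ k (j + 1)
      + 2 * lam * h (k + 1, j) + μ₁ * h (k + 2, j + 1) + μ₂ * h (k + 1, j + 2) := by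
  have := hb (k + 1, j + 1)
  simp only [outRate, inflow, shift, arr_of_lt (Nat.succ_lt_succ hj),
    arr_of_gt (Nat.succ_lt_succ hj), arr_of_lt (show j < k + 1 by omega)] at this
  linear_combination this

theorem Balanced.diag_succ (hb : Balanced K lam μ₁ μ₂ p₁ p₂ h) (hp : p₁ + p₂ = 1) (k : ℕ) :
    (2 * lam * below K (k + 1) + μ₁ + μ₂) * h (k + 1, k + 1) = 2 * lam * h (k + 1, k)
      + 2 * lam * h (k, k + 1) + μ₁ * h (k + 2, k + 1) + μ₂ * h (k + 1, k + 2) := by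
  have := hb (k + 1, k + 1)
  simp only [outRate, inflow, shift, arr_self, arr_of_lt (Nat.lt_add_one k)] at this
  linear_combination this - 2 * lam * below K (k + 1) * h (k + 1, k + 1) * hp

theorem Balanced.origin (hb : Balanced K lam μ₁ μ₂ p₁ p₂ h) (hp : p₁ + p₂ = 1) :
    2 * lam * below K 0 * h (0, 0) = μ₁ * h (1, 0) + μ₂ * h (0, 1) := by
  have := hb (0, 0)
  simp only [outRate, inflow, shift, arr_self] at this
  linear_combination this - 2 * lam * below K 0 * h (0, 0) * hp

/-- Below the diagonal, a solution of the balance equations is given by its boundary values. -/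
theorem Balanced.eq_tri (hl : 0 < lam) (hμ₁ : 0 < μ₁) (hμ₂ : 0 < μ₂)
    (hb : Balanced K lam μ₁ μ₂ p₁ p₂ h) {k j : ℕ} (hjk : j < k) :
    h (k, j) = tri lam μ₁ μ₂ (fun l => h (l, 0)) k j := by
  -- The balance at (k, j), for j + 1 < k, can be solved for h (k, j+1) from rows j - 1 and j; no
  -- arrivals from the diagonal enter there.
  have both : ∀ j, (∀ k, j < k → h (k, j) = tri lam μ₁ μ₂ (fun l => h (l, 0)) k j) ∧
      ∀ k, j + 1 < k → h (k, j + 1) = tri lam μ₁ μ₂ (fun l => h (l, 0)) k (j + 1) := by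
    intro j
    induction j with
    | zero =>
      have z : ∀ k, 0 < k → h (k, 0) = tri lam μ₁ μ₂ (fun l => h (l, 0)) k 0 :=
        fun k _ => by rw [tri_zero_right hl hμ₁ hμ₂]
      refine ⟨z, fun k hk => mul_left_cancel₀ hμ₂.ne' ?_⟩
      obtain ⟨k, rfl⟩ := Nat.exists_eq_add_of_le' (show 1 ≤ k by omega)
      have e := hb.lower_zero k
      have e' := tri_rec_zero hl hμ₁ hμ₂ (fun l => h (l, 0)) (k + 1)
      rw [arr_of_gt (by omega)] at e
      rw [← z _ (by omega), ← z _ (by omega)] at e'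
      linear_combination e' - e
    | succ j ih =>
      refine ⟨ih.2, fun k hk => mul_left_cancel₀ hμ₂.ne' ?_⟩
      obtain ⟨k, rfl⟩ := Nat.exists_eq_add_of_le' (show 1 ≤ k by omega)
      have e := hb.lower_succ (show j < k by omega)
      have e' := tri_rec_succ hl hμ₁ hμ₂ (fun l => h (l, 0)) (k + 1) j
      rw [arr_of_gt (by omega)] at e
      rw [← ih.2 _ (by omega), ← ih.2 _ (by omega), ← ih.1 _ (by omega)] at e'
      linear_combination e' - e
  exact (both j).1 k hjk

/-- `tri` continues the interior recursion up to the diagonal, whereas the true balance at (k+1, k)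
has an additional inflow from (k, k). Comparison gives the discrepancy. -/
theorem Balanced.tri_diag (hl : 0 < lam) (hμ₁ : 0 < μ₁) (hμ₂ : 0 < μ₂)
    (hb : Balanced K lam μ₁ μ₂ p₁ p₂ h) (k : ℕ) :
    μ₂ * tri lam μ₁ μ₂ (fun l => h (l, 0)) (k + 1) (k + 1) =
      μ₂ * h (k + 1, k + 1) + 2 * lam * p₁ * (below K k * h (k, k)) := by
  cases k with
  | zero =>
    have e := hb.lower_zero 0
    have e' := tri_rec_zero hl hμ₁ hμ₂ (fun l => h (l, 0)) 1
    rw [← hb.eq_tri hl hμ₁ hμ₂ (by omega), ← hb.eq_tri hl hμ₁ hμ₂ (by omega)] at e'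
    rw [arr_self] at e
    linear_combination e - e'
  | succ k =>
    have e := hb.lower_succ (Nat.lt_add_one k)
    have e' := tri_rec_succ hl hμ₁ hμ₂ (fun l => h (l, 0)) (k + 2) k
    rw [← hb.eq_tri hl hμ₁ hμ₂ (show k + 1 < k + 2 by omega),
      ← hb.eq_tri hl hμ₁ hμ₂ (show k + 1 < k + 2 + 1 by omega),
      ← hb.eq_tri hl hμ₁ hμ₂ (show k < k + 2 by omega)] at e'
    rw [arr_self] at e
    linear_combination e - e'

/-- The cut equation across max(L₁, L₂) = k, with both triangle sums telescoped. In the induction,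
`tri_cut` for each triangle, the balance at (k+1, k+1) and the discrepancies from
`Balanced.tri_diag` carry the cut from k to k + 1. -/
theorem Balanced.eq_triDiag (hl : 0 < lam) (hμ₁ : 0 < μ₁) (hμ₂ : 0 < μ₂) (hp : p₁ + p₂ = 1)
    (hb : Balanced K lam μ₁ μ₂ p₁ p₂ h) (k : ℕ) :
    below K k * h (k, k) =
      triDiag lam μ₁ μ₂ (fun l => h (l, 0)) (fun l => h (0, l)) k := by
  have hb' := hb.swap
  induction k with
  | zero =>
    have e := hb.origin hp
    simp only [triDiag, zero_add, convSum_one_right hl hμ₁ hμ₂, convSum_one_right hl hμ₂ hμ₁]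
    field_simp
    linear_combination e
  | succ k ih =>
    have d := hb.diag_succ hp k
    have c₁ := tri_cut hl hμ₁ hμ₂ (fun l => h (l, 0)) k
    have c₂ := tri_cut hl hμ₂ hμ₁ (fun l => h (0, l)) k
    have t₁ := hb.tri_diag hl hμ₁ hμ₂ k
    have t₂ := hb'.tri_diag hl hμ₂ hμ₁ k
    rw [← hb.eq_tri hl hμ₁ hμ₂ (by omega), ← hb.eq_tri hl hμ₁ hμ₂ (by omega)] at c₁
    have u : ∀ {k j}, j < k → h (j, k) = tri lam μ₂ μ₁ (fun l => h (0, l)) k j :=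
      fun hjk => hb'.eq_tri hl hμ₂ hμ₁ hjk
    rw [← u (by omega), ← u (by omega)] at c₂
    have i : 2 * lam * (below K k * h (k, k)) =
        -(μ₂ * convSum lam μ₁ μ₂ (fun l => h (l, 0)) (k + 1) (k + 1)
        + μ₁ * convSum lam μ₂ μ₁ (fun l => h (0, l)) (k + 1) (k + 1)) := by
      rw [ih, triDiag]; field_simp
    refine mul_left_cancel₀ (show 2 * lam ≠ 0 by positivity) ?_
    rw [triDiag]
    field_simp
    simp only at t₂
    linear_combination d + c₁ + c₂ + t₁ + t₂ + i + 2 * lam * (below K k * h (k, k)) * hp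

/-- The boundary relations in terms of power series coefficients, for one of the queues. -/
def CoeffRelation (K : ℕ∞) (lam μ₁ μ₂ p₁ : ℝ) (a b : ℕ → ℝ) (κ : ℝ) : Prop :=
  ∀ k : ℕ, μ₂ * tri lam μ₁ μ₂ a k k =
    μ₂ * (triDiag lam μ₁ μ₂ a b k + if (k : ℕ∞) = K then κ else 0)
      + 2 * lam * p₁ * shift (triDiag lam μ₁ μ₂ a b) k

theorem Balanced.coeffRelation (hl : 0 < lam) (hμ₁ : 0 < μ₁) (hμ₂ : 0 < μ₂) (hp : p₁ + p₂ = 1)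
    (hb : Balanced K lam μ₁ μ₂ p₁ p₂ h) {κ : ℝ} (hκ : ∀ k : ℕ, h (k, k) = below K k * h (k, k)
      + if (k : ℕ∞) = K then κ else 0) :
    CoeffRelation K lam μ₁ μ₂ p₁ (fun l => h (l, 0)) (fun l => h (0, l)) κ := fun k => by
  rw [← hb.eq_triDiag hl hμ₁ hμ₂ hp, ← hκ]
  cases k with
  | zero => rw [tri_zero_right hl hμ₁ hμ₂]; simp [shift]
  | succ k =>
    rw [hb.tri_diag hl hμ₁ hμ₂]
    simp only [shift, hb.eq_triDiag hl hμ₁ hμ₂ hp]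

/-- The array built from `a`, `b` and the corner value `κ`. -/
def array (K : ℕ∞) (lam μ₁ μ₂ : ℝ) (a b : ℕ → ℝ) (κ : ℝ) (v : ℕ × ℕ) : ℝ :=
  if v.2 < v.1 then tri lam μ₁ μ₂ a v.1 v.2
  else if v.1 < v.2 then tri lam μ₂ μ₁ b v.2 v.1
  else triDiag lam μ₁ μ₂ a b v.1 + if (v.1 : ℕ∞) = K then κ else 0

variable {a b : ℕ → ℝ} {κ : ℝ}

theorem array_of_gt {i j : ℕ} (hij : j < i) :
    array K lam μ₁ μ₂ a b κ (i, j) = tri lam μ₁ μ₂ a i j := if_pos hij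

theorem array_of_lt {i j : ℕ} (hij : i < j) :
    array K lam μ₁ μ₂ a b κ (i, j) = tri lam μ₂ μ₁ b j i := by
  rw [array, if_neg (by simp; omega), if_pos hij]

theorem array_self (k : ℕ) : array K lam μ₁ μ₂ a b κ (k, k) =
    triDiag lam μ₁ μ₂ a b k + if (k : ℕ∞) = K then κ else 0 := by
  rw [array, if_neg (by simp), if_neg (by simp)]

theorem array_swap (v : ℕ × ℕ) :
    array K lam μ₁ μ₂ a b κ (v.2, v.1) = array K lam μ₂ μ₁ b a κ v := by
  obtain ⟨i, j⟩ := v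
  rcases lt_trichotomy i j with hij | rfl | hij
  · rw [array_of_gt hij, array_of_lt hij]
  · rw [array_self, array_self, triDiag_comm]
  · rw [array_of_lt hij, array_of_gt hij]

/-- Only entries with index at least k + 1 enter. The cut formula therefore gives no information
about (K, K), and κ has to be a separate unknown. -/
theorem triDiag_eq_zero (ha : ∀ l : ℕ, K < l → a l = 0) (hb : ∀ l : ℕ, K < l → b l = 0) {k : ℕ}
    (hk : K ≤ k) : triDiag lam μ₁ μ₂ a b k = 0 := by
  have hlt : ∀ l : ℕ, k + 1 ≤ l → K < l := fun l hkl =>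
    hk.trans_lt (by exact_mod_cast hkl)
  rw [triDiag, convSum_eq_zero fun l hkl => ha l (hlt l hkl),
    convSum_eq_zero fun l hkl => hb l (hlt l hkl)]
  simp

theorem below_mul_array (ha : ∀ l : ℕ, K < l → a l = 0) (hb : ∀ l : ℕ, K < l → b l = 0) (k : ℕ) :
    below K k * array K lam μ₁ μ₂ a b κ (k, k) = triDiag lam μ₁ μ₂ a b k := by
  rw [array_self, below]
  split_ifs with h₁ h₂ h₂
  · exact absurd h₁ (by simp [h₂])
  · ring
  · rw [triDiag_eq_zero ha hb (not_lt.1 h₁)]; ring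
  · rw [triDiag_eq_zero ha hb (not_lt.1 h₁)]; ring

theorem array_balance_lower (hl : 0 < lam) (hμ₁ : 0 < μ₁) (hμ₂ : 0 < μ₂)
    (ha : ∀ l : ℕ, K < l → a l = 0) (hb : ∀ l : ℕ, K < l → b l = 0)
    (hc : CoeffRelation K lam μ₁ μ₂ p₁ a b κ) {k j : ℕ} (hjk : j < k + 1) :
    array K lam μ₁ μ₂ a b κ (k + 1, j) * outRate K lam μ₁ μ₂ p₁ p₂ (k + 1, j) =
      inflow K lam μ₁ μ₂ p₁ p₂ (array K lam μ₁ μ₂ a b κ) (k + 1, j) := by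
  -- On j = k this is the coefficient relation at k + 1, and for j < k it is trivial. In both cases
  -- the balance at (k+1, j) becomes the recursion of `tri`.
  have hedge : array K lam μ₁ μ₂ a b κ (k, j) * arr K lam p₁ k j
      + μ₂ * array K lam μ₁ μ₂ a b κ (k + 1, j + 1) = μ₂ * tri lam μ₁ μ₂ a (k + 1) (j + 1) := by
    rcases Nat.lt_or_ge j k with h' | h'
    · rw [arr_of_gt h', array_of_gt (Nat.succ_lt_succ h')]; ring
    · obtain rfl : j = k := by omega
      have := hc (j + 1)
      rw [← array_self, shift, ← below_mul_array (κ := κ) ha hb] at this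
      rw [arr_self]
      linear_combination -this
  cases j with
  | zero =>
    have e := tri_rec_zero hl hμ₁ hμ₂ a (k + 1)
    simp only [outRate, inflow, shift, arr_of_lt hjk, arr_of_gt hjk]
    rw [array_of_gt hjk, array_of_gt (Nat.succ_pos _)]
    linear_combination e - hedge
  | succ j =>
    have e := tri_rec_succ hl hμ₁ hμ₂ a (k + 1) j
    simp only [outRate, inflow, shift, arr_of_lt hjk, arr_of_gt hjk,
      arr_of_lt (show j < k + 1 by omega)]
    rw [array_of_gt hjk, array_of_gt (show j + 1 < k + 1 + 1 by omega),
      array_of_gt (show j < k + 1 by omega)]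
    linear_combination e - hedge

/-- The array built from solutions of the coefficient relations solves the balance equations. -/
theorem balanced_array (hl : 0 < lam) (hμ₁ : 0 < μ₁) (hμ₂ : 0 < μ₂) (hp : p₁ + p₂ = 1)
    (ha : ∀ l : ℕ, K < l → a l = 0) (hb : ∀ l : ℕ, K < l → b l = 0)
    (hc : CoeffRelation K lam μ₁ μ₂ p₁ a b κ) (hc' : CoeffRelation K lam μ₂ μ₁ p₂ b a κ) :
    Balanced K lam μ₁ μ₂ p₁ p₂ (array K lam μ₁ μ₂ a b κ) := by
  rintro ⟨i, j⟩
  rcases lt_trichotomy i j with hij | rfl | hij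
  · obtain ⟨k, rfl⟩ := Nat.exists_eq_add_of_le' (show 1 ≤ j by omega)
    have e := array_balance_lower (p₂ := p₁) hl hμ₂ hμ₁ hb ha hc' hij
    rw [← funext (array_swap (K := K) (a := a) (b := b) (κ := κ))] at e
    simp only [outRate, inflow] at e ⊢
    linear_combination e
  · cases i with
    | zero =>
      have e := below_mul_array (lam := lam) (μ₁ := μ₁) (μ₂ := μ₂) (κ := κ) ha hb 0
      simp only [outRate, inflow, shift, arr_self]
      rw [array_of_gt (show 0 < 0 + 1 by omega), array_of_lt (show 0 < 0 + 1 by omega)]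
      simp only [triDiag, zero_add, convSum_one_right hl hμ₁ hμ₂, convSum_one_right hl hμ₂ hμ₁,
        tri_zero_right hl hμ₁ hμ₂, tri_zero_right hl hμ₂ hμ₁] at e ⊢
      field_simp at e
      linear_combination e + 2 * lam * below K 0 * array K lam μ₁ μ₂ a b κ (0, 0) * hp
    | succ k =>
      have e := below_mul_array (lam := lam) (μ₁ := μ₁) (μ₂ := μ₂) (κ := κ) ha hb (k + 1)
      have s := array_self (K := K) (lam := lam) (μ₁ := μ₁) (μ₂ := μ₂) (a := a) (b := b) (κ := κ)
        (k + 1)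
      have c₁ := tri_cut hl hμ₁ hμ₂ a k
      have c₂ := tri_cut hl hμ₂ hμ₁ b k
      have t₁ := hc (k + 1)
      have t₂ := hc' (k + 1)
      rw [triDiag_comm, funext (triDiag_comm μ₂ μ₁ b a)] at t₂
      rw [← s] at t₁ t₂
      simp only [outRate, inflow, shift, arr_self, arr_of_lt (Nat.lt_add_one k)] at t₁ t₂ ⊢
      rw [array_of_gt (show k + 1 < k + 1 + 1 by omega), array_of_gt (show k < k + 1 by omega),
        array_of_lt (show k + 1 < k + 1 + 1 by omega), array_of_lt (show k < k + 1 by omega)]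
      have d₁ : 2 * lam * triDiag lam μ₁ μ₂ a b (k + 1) =
          -(μ₂ * convSum lam μ₁ μ₂ a (k + 2) (k + 2)
            + μ₁ * convSum lam μ₂ μ₁ b (k + 2) (k + 2)) := by
        rw [triDiag]; field_simp
      have d₀ : 2 * lam * triDiag lam μ₁ μ₂ a b k =
          -(μ₂ * convSum lam μ₁ μ₂ a (k + 1) (k + 1)
            + μ₁ * convSum lam μ₂ μ₁ b (k + 1) (k + 1)) := by
        rw [triDiag]; field_simp
      linear_combination d₁ - d₀ - c₁ - c₂ - t₁ - t₂ + 2 * lam * e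
        + 2 * lam * below K (k + 1) * array K lam μ₁ μ₂ a b κ (k + 1, k + 1) * hp
        - 2 * lam * triDiag lam μ₁ μ₂ a b k * hp
  · obtain ⟨k, rfl⟩ := Nat.exists_eq_add_of_le' (show 1 ≤ i by omega)
    exact array_balance_lower hl hμ₁ hμ₂ ha hb hc hij

end Triangle

/-! ### Functional equations as relations between coefficients -/

section Relations

variable {K : ℕ∞} {lam μ₁ μ₂ p₁ p₂ κ : ℝ} {a b : ℕ → ℝ}

theorem genTerm_eq (K : ℕ∞) (a : ℕ → ℝ) (y : ℂ) :
    genTerm K a y = fun k => (trunc K a k : ℂ) * y ^ k := by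
  funext k
  simp only [genTerm, trunc]
  split_ifs <;> simp

theorem gen_eq (K : ℕ∞) (a : ℕ → ℝ) (y : ℂ) : gen K a y = ∑' k, (trunc K a k : ℂ) * y ^ k := by
  rw [gen, genTerm_eq]

/-- For K = ⊤ one has `K.toNat` = 0, so κ = 0 is what removes the term. -/
theorem hasSum_corner_term (hκ : K = ⊤ → κ = 0) (x : ℂ) :
    HasSum (fun k : ℕ => ((if (k : ℕ∞) = K then κ else 0 : ℝ) : ℂ) * x ^ k)
      (x ^ K.toNat * κ) := by
  induction K using ENat.recTopCoe with
  | top => simp [hκ rfl]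
  | coe n =>
    have := hasSum_single (f := fun k : ℕ => ((if (k : ℕ∞) = n then κ else 0 : ℝ) : ℂ) * x ^ k) n
      fun k hk => by simp [hk]
    rw [ENat.toNat_natCast, mul_comm]
    simpa only [if_true] using this

/-- The coefficientwise defect of the first functional equation. -/
def coeffDefect (K : ℕ∞) (lam μ₁ μ₂ p₁ : ℝ) (a b : ℕ → ℝ) (κ : ℝ) (k : ℕ) : ℝ :=
  μ₂ * tri lam μ₁ μ₂ a k k - (μ₂ * (triDiag lam μ₁ μ₂ a b k + if (k : ℕ∞) = K then κ else 0)
    + 2 * lam * p₁ * shift (triDiag lam μ₁ μ₂ a b) k)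

theorem coeffRelation_iff :
    CoeffRelation K lam μ₁ μ₂ p₁ a b κ ↔ ∀ k, coeffDefect K lam μ₁ μ₂ p₁ a b κ k = 0 :=
  forall_congr' fun _ => sub_eq_zero.symm

theorem eventually_hasSum_coeffDefect (hl : 0 < lam) (hμ₁ : 0 < μ₁) (hμ₂ : 0 < μ₂)
    (p₁ : ℝ) (hκ : K = ⊤ → κ = 0) (ha : GeomBounded (trunc K a)) (hb : GeomBounded (trunc K b)) :
    ∀ᶠ x : ℂ in 𝓝[≠] 0, ∀ y₁ z₁ y₂ z₂ : ℂ,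
      (poly lam μ₁ μ₂ x).roots = {y₁, z₁} → (poly lam μ₂ μ₁ x).roots = {y₂, z₂} →
      HasSum (fun k =>
          (coeffDefect K lam μ₁ μ₂ p₁ (trunc K a) (trunc K b) κ k : ℂ) * x ^ k)
        (μ₂ / (y₁ - z₁) * ((y₁ - x) * gen K a y₁ - (z₁ - x) * gen K a z₁)
          - (μ₂ * x ^ K.toNat * κ + (μ₂ + 2 * p₁ * lam * x) / (2 * lam) *
            (μ₁ * ((gen K a y₁ - gen K a z₁) / (y₁ - z₁))
              + μ₂ * ((gen K b y₂ - gen K b z₂) / (y₂ - z₂))))) := by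
  filter_upwards [eventually_hasSum_convSum hl hμ₁ hμ₂ ha, eventually_hasSum_convSum hl hμ₂ hμ₁ hb,
    eventually_hasSum_tri hl hμ₁ hμ₂ ha] with x h₁ h₂ h₃ y₁ z₁ y₂ z₂ hr₁ hr₂
  obtain ⟨hne₁, -, -, c₁⟩ := h₁ _ _ hr₁
  obtain ⟨hne₂, -, -, c₂⟩ := h₂ _ _ hr₂
  have t := h₃ _ _ hr₁
  simp only [← gen_eq] at c₁ c₂ t
  have hl' : (lam : ℂ) ≠ 0 := by exact_mod_cast hl.ne'
  have hμ₁' : (μ₁ : ℂ) ≠ 0 := by exact_mod_cast hμ₁.ne'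
  have hμ₂' : (μ₂ : ℂ) ≠ 0 := by exact_mod_cast hμ₂.ne'
  have d := ((c₁.mul_left (μ₂ : ℂ)).add (c₂.mul_left (μ₁ : ℂ))).mul_left (-(1 / (2 * lam)) : ℂ)
  have d' : HasSum (fun k => (triDiag lam μ₁ μ₂ (trunc K a) (trunc K b) k : ℂ) * x ^ k) _ :=
    d.congr_fun fun k => by rw [triDiag]; push_cast; ring
  have total := (t.mul_left (μ₂ : ℂ)).sub (((d'.add (hasSum_corner_term hκ x)).mul_left
    (μ₂ : ℂ)).add ((hasSum_pow_shift d').mul_left (2 * lam * p₁ : ℂ)))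
  have e : ∀ {s s' : ℂ}, s = s' → HasSum (fun k =>
      (coeffDefect K lam μ₁ μ₂ p₁ (trunc K a) (trunc K b) κ k : ℂ) * x ^ k) s → HasSum (fun k =>
      (coeffDefect K lam μ₁ μ₂ p₁ (trunc K a) (trunc K b) κ k : ℂ) * x ^ k) s' :=
    fun h h' => h ▸ h'
  refine e ?_ (total.congr_fun fun k => ?_)
  · generalize (gen K a y₁ - gen K a z₁) / (y₁ - z₁) = q₁
    generalize (gen K b y₂ - gen K b z₂) / (y₂ - z₂) = q₂
    field_simp
    ring
  · rw [coeffDefect]; push_cast; ring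

theorem eventually_summable_genTerm (hl : 0 < lam) (hμ₁ : 0 < μ₁) (hμ₂ : 0 < μ₂)
    (ha : GeomBounded (trunc K a)) :
    ∀ᶠ x : ℂ in 𝓝[≠] 0, ∀ y z : ℂ, (poly lam μ₁ μ₂ x).roots = {y, z} →
      Summable (genTerm K a y) ∧ Summable (genTerm K a z) := by
  filter_upwards [eventually_hasSum_convSum hl hμ₁ hμ₂ ha] with x h y z hr
  rw [genTerm_eq, genTerm_eq]
  exact ⟨(h y z hr).2.1, (h y z hr).2.2.1⟩

/-- Convergence at one nonzero argument bounds the coefficients geometrically. For small x ≠ 0 the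
product of the roots is a nonzero multiple of (μ + 2λx)x, so no root is zero. -/
theorem BoundaryRelations.geomBounded (hμ₁ : 0 < μ₁) (hμ₂ : 0 < μ₂)
    (h : BoundaryRelations K lam μ₁ μ₂ p₁ p₂ a b κ) :
    GeomBounded (trunc K a) ∧ GeomBounded (trunc K b) := by
  have hne : ∀ {μ : ℝ}, 0 < μ → ∀ᶠ x : ℂ in 𝓝[≠] 0, (μ + 2 * lam * x : ℂ) ≠ 0 := fun {μ} hμ => by
    have hc : Continuous fun x : ℂ => (μ + 2 * lam * x : ℂ) := by fun_prop
    exact nhdsWithin_le_nhds (hc.continuousAt.eventually_ne (by simpa using hμ.ne'))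
  obtain ⟨x, hx, h₁, h₂, hx0⟩ := (h.and ((hne hμ₁).and ((hne hμ₂).and self_mem_nhdsWithin))).exists
  obtain ⟨y₁, z₁, hr₁⟩ := exists_roots_poly (lam := lam) (μ := μ₁) hμ₂ x
  obtain ⟨y₂, z₂, hr₂⟩ := exists_roots_poly (lam := lam) (μ := μ₂) hμ₁ x
  obtain ⟨s₁, -, s₂, -, -⟩ := hx y₁ z₁ y₂ z₂ hr₁ hr₂
  rw [genTerm_eq] at s₁ s₂
  constructor
  · refine GeomBounded.of_summable (fun hy => ?_) s₁
    have := ((roots_poly_iff hμ₂).1 hr₁).2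
    rw [hy, zero_mul, mul_zero] at this
    exact mul_ne_zero h₁ hx0 this.symm
  · refine GeomBounded.of_summable (fun hy => ?_) s₂
    have := ((roots_poly_iff hμ₁).1 hr₂).2
    rw [hy, zero_mul, mul_zero] at this
    exact mul_ne_zero h₂ hx0 this.symm

/-- The functional equations are equivalent to the relations between coefficients. -/
theorem boundaryRelations_iff (hl : 0 < lam) (hμ₁ : 0 < μ₁) (hμ₂ : 0 < μ₂)
    (hκ : K = ⊤ → κ = 0) :
    BoundaryRelations K lam μ₁ μ₂ p₁ p₂ a b κ ↔
      (GeomBounded (trunc K a) ∧ GeomBounded (trunc K b)) ∧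
        CoeffRelation K lam μ₁ μ₂ p₁ (trunc K a) (trunc K b) κ ∧
        CoeffRelation K lam μ₂ μ₁ p₂ (trunc K b) (trunc K a) κ := by
  rw [coeffRelation_iff, coeffRelation_iff]
  constructor
  · intro h
    have hg := h.geomBounded hμ₁ hμ₂
    refine ⟨hg, fun k => ?_, fun k => ?_⟩
    · refine Complex.ofReal_eq_zero.1 (eq_zero_of_eventually_hasSum
        (R := fun k => (coeffDefect K lam μ₁ μ₂ p₁ (trunc K a) (trunc K b) κ k : ℂ)) ?_ k)
      filter_upwards [h, eventually_hasSum_coeffDefect hl hμ₁ hμ₂ p₁ hκ hg.1 hg.2] with x hx hs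
      obtain ⟨y₁, z₁, hr₁⟩ := exists_roots_poly (lam := lam) (μ := μ₁) hμ₂ x
      obtain ⟨y₂, z₂, hr₂⟩ := exists_roots_poly (lam := lam) (μ := μ₂) hμ₁ x
      have hs' := hs y₁ z₁ y₂ z₂ hr₁ hr₂
      rwa [sub_eq_zero.2 (hx y₁ z₁ y₂ z₂ hr₁ hr₂).2.2.2.2.1] at hs'
    · refine Complex.ofReal_eq_zero.1 (eq_zero_of_eventually_hasSum
        (R := fun k => (coeffDefect K lam μ₂ μ₁ p₂ (trunc K b) (trunc K a) κ k : ℂ)) ?_ k)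
      filter_upwards [h, eventually_hasSum_coeffDefect hl hμ₂ hμ₁ p₂ hκ hg.2 hg.1] with x hx hs
      obtain ⟨y₁, z₁, hr₁⟩ := exists_roots_poly (lam := lam) (μ := μ₁) hμ₂ x
      obtain ⟨y₂, z₂, hr₂⟩ := exists_roots_poly (lam := lam) (μ := μ₂) hμ₁ x
      have hs' := hs y₂ z₂ y₁ z₁ hr₂ hr₁
      rwa [add_comm (μ₂ * _ : ℂ), sub_eq_zero.2 (hx y₁ z₁ y₂ z₂ hr₁ hr₂).2.2.2.2.2] at hs'
  · rintro ⟨⟨ha, hb⟩, h₁, h₂⟩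
    filter_upwards [eventually_summable_genTerm hl hμ₁ hμ₂ ha,
      eventually_summable_genTerm hl hμ₂ hμ₁ hb,
      eventually_hasSum_coeffDefect hl hμ₁ hμ₂ p₁ hκ ha hb,
      eventually_hasSum_coeffDefect hl hμ₂ hμ₁ p₂ hκ hb ha] with x s₁ s₂ d₁ d₂ y₁ z₁ y₂ z₂ hr₁ hr₂
    refine ⟨(s₁ _ _ hr₁).1, (s₁ _ _ hr₁).2, (s₂ _ _ hr₂).1, (s₂ _ _ hr₂).2, ?_, ?_⟩
    · have := d₁ y₁ z₁ y₂ z₂ hr₁ hr₂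
      simp only [h₁, Complex.ofReal_zero, zero_mul] at this
      exact sub_eq_zero.1 (this.unique hasSum_zero)
    · have := d₂ y₂ z₂ y₁ z₁ hr₂ hr₁
      simp only [h₂, Complex.ofReal_zero, zero_mul] at this
      rw [add_comm (μ₂ * _ : ℂ)] at this
      exact sub_eq_zero.1 (this.unique hasSum_zero)

end Relations

/-! ### Explicit formulas and characterization up to a factor -/

section Stationary

variable {K : ℕ∞} {lam μ₁ μ₂ p₁ p₂ κ : ℝ} {a b : ℕ → ℝ} {h π : ℕ × ℕ → ℝ}

theorem trunc_eq_self (ha : ∀ l : ℕ, K < l → a l = 0) : trunc K a = a := by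
  funext l
  rcases le_or_gt (l : ℕ∞) K with hl | hl
  · exact trunc_of_le hl a
  · rw [trunc_of_lt hl, ha l hl]

theorem Balanced.smul (hb : Balanced K lam μ₁ μ₂ p₁ p₂ h) (c : ℝ) :
    Balanced K lam μ₁ μ₂ p₁ p₂ fun v => c * h v := by
  rintro ⟨i, j⟩
  have e := hb (i, j)
  cases i <;> cases j <;> simp only [inflow, shift] at e ⊢ <;> linear_combination c * e

theorem corner_coe (n : ℕ) (π : ℕ × ℕ → ℝ) : corner n π = π (n, n) := by simp [corner]

theorem corner_top (π : ℕ × ℕ → ℝ) : corner ⊤ π = 0 := if_pos rfl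

theorem diag_eq (hs : ∀ v : ℕ × ℕ, ¬ ((v.1 : ℕ∞) ≤ K ∧ (v.2 : ℕ∞) ≤ K) → h v = 0) (k : ℕ) :
    h (k, k) = below K k * h (k, k) + if (k : ℕ∞) = K then corner K h else 0 := by
  rcases lt_trichotomy (k : ℕ∞) K with hk | rfl | hk
  · simp [below, hk, hk.ne]
  · simp [below, corner_coe]
  · rw [hs (k, k) (by simp [hk])]
    simp [hk.ne']

theorem below_of_lt {k : ℕ} (hk : (k : ℕ∞) < K) : below K k = 1 := if_pos hk

theorem Balanced.eq_offDiagSum (hl : 0 < lam) (hμ₁ : 0 < μ₁) (hμ₂ : 0 < μ₂)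
    (hb : Balanced K lam μ₁ μ₂ p₁ p₂ h) (h0 : ∀ l : ℕ, K < l → h (l, 0) = 0) {k j : ℕ}
    (hjk : j < k) :
    h (k, j) = μ₂ / μ₁ * offDiagSum K (g lam μ₁ μ₂) (fun l => h (l, 0)) k j := by
  rw [offDiagSum_eq_tri, trunc_eq_self h0, hb.eq_tri hl hμ₁ hμ₂ hjk]

theorem Balanced.eq_diagSum (hl : 0 < lam) (hμ₁ : 0 < μ₁) (hμ₂ : 0 < μ₂) (hp : p₁ + p₂ = 1)
    (hb : Balanced K lam μ₁ μ₂ p₁ p₂ h) (h0 : ∀ l : ℕ, K < l → h (l, 0) = 0)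
    (h0' : ∀ l : ℕ, K < l → h (0, l) = 0) {k : ℕ} (hk : (k : ℕ∞) < K) :
    h (k, k) = diagSum K lam μ₁ μ₂ (fun l => h (l, 0)) (fun l => h (0, l)) k := by
  rw [diagSum_eq_triDiag, trunc_eq_self h0, trunc_eq_self h0', ← hb.eq_triDiag hl hμ₁ hμ₂ hp,
    below_of_lt hk, one_mul]

theorem Balanced.extension_eq (hl : 0 < lam) (hμ₁ : 0 < μ₁) (hμ₂ : 0 < μ₂) (hp : p₁ + p₂ = 1)
    (hb : Balanced ⊤ lam μ₁ μ₂ p₁ p₂ h) :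
    extension lam μ₁ μ₂ (fun l => h (l, 0)) (fun l => h (0, l)) = h := by
  have h0 : ∀ (f : ℕ → ℝ) (l : ℕ), ⊤ < (l : ℕ∞) → f l = 0 := fun f l hlt => absurd hlt not_top_lt
  funext ⟨i, j⟩
  rcases lt_trichotomy i j with hij | rfl | hij
  · rw [extension, if_neg (by simp; omega), if_pos hij]
    exact (hb.swap.eq_offDiagSum hl hμ₂ hμ₁ (h0 _) hij).symm
  · rw [extension, if_neg (by simp), if_neg (by simp)]
    exact (hb.eq_diagSum hl hμ₁ hμ₂ hp (h0 _) (h0 _) (ENat.natCast_lt_top i)).symm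
  · rw [extension, if_pos hij]
    exact (hb.eq_offDiagSum hl hμ₁ hμ₂ (h0 _) hij).symm

/-- Balance at (K, K), whose only inflow is by arrivals from (K, K-1) and (K-1, K). In the formula
for these two values only the summand l = K survives. -/
theorem Balanced.corner_eq (hl : 0 < lam) (hμ₁ : 0 < μ₁) (hμ₂ : 0 < μ₂) (hp : p₁ + p₂ = 1)
    {n : ℕ} (hn : 1 ≤ n) (hb : Balanced n lam μ₁ μ₂ p₁ p₂ h)
    (hs : ∀ v : ℕ × ℕ, ¬ ((v.1 : ℕ∞) ≤ n ∧ (v.2 : ℕ∞) ≤ n) → h v = 0) :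
    h (n, n) = 2 * lam / (μ₁ + μ₂) *
      (μ₂ / μ₁ * h (n, 0) * (g lam μ₁ μ₂ (n - 1) - g lam μ₁ μ₂ n)
        + μ₁ / μ₂ * h (0, n) * (g lam μ₂ μ₁ (n - 1) - g lam μ₂ μ₁ n)) := by
  obtain ⟨k, rfl⟩ := Nat.exists_eq_add_of_le' hn
  have e := hb.diag_succ hp k
  rw [hs (k + 2, k + 1) (by simp), hs (k + 1, k + 2) (by simp),
    show below ((k + 1 : ℕ) : ℕ∞) (k + 1) = 0 by simp [below]] at e
  have conv₁ : ∀ {μ ν : ℝ} {a : ℕ → ℝ}, (∀ l, k + 2 ≤ l → a l = 0) →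
      tri lam μ ν a (k + 1) k = ν / μ * a (k + 1) * (g lam μ ν k - g lam μ ν (k + 1)) := by
    intro μ ν a ha
    have hc : ∀ n, convSum lam μ ν a (k + 1) n = a (k + 1) * g lam μ ν n := fun n => by
      rw [convSum_eq_sum_range a (k + 1) (Nat.le_succ n), Finset.sum_range_succ',
        Finset.sum_eq_zero fun m _ => by rw [ha _ (by omega), zero_mul]]
      simp [convPow_one]
    rw [tri, hc, hc]; ring
  have t₁ := hb.eq_tri hl hμ₁ hμ₂ (show k < k + 1 by omega)
  have t₂ := hb.swap.eq_tri hl hμ₂ hμ₁ (show k < k + 1 by omega)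
  rw [conv₁ fun l hkl => hs (l, 0) fun hv => by
    have : l ≤ k + 1 := by exact_mod_cast hv.1
    omega] at t₁
  rw [conv₁ fun l hkl => hs (0, l) fun hv => by
    have : l ≤ k + 1 := by exact_mod_cast hv.2
    omega] at t₂
  simp only at t₂
  rw [Nat.add_sub_cancel, ← t₁, ← t₂]
  field_simp
  linear_combination e

/-- A summable solution of the balance equations that is a multiple of another at the origin is
a multiple everywhere. -/
theorem Balanced.eq_smul (hl : 0 < lam) (hμ₁ : 0 < μ₁) (hμ₂ : 0 < μ₂) (hp₁ : 0 ≤ p₁)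
    (hp₂ : 0 ≤ p₂) (hp : p₁ + p₂ = 1) (hb : Balanced K lam μ₁ μ₂ p₁ p₂ h) (hs : Summable h)
    (hπ : IsStationary K lam μ₁ μ₂ p₁ p₂ π) : ∃ c : ℝ, ∀ v, h v = c * π v := by
  have h0 : π (0, 0) ≠ 0 := fun h0 => by
    have hz := hπ.balanced.eq_zero hl hμ₁ hμ₂ hp₁ (by linarith) hp₂ (by linarith)
      hπ.hasSum_one.summable h0
    have := hπ.hasSum_one
    rw [show π = fun _ => 0 from funext hz] at this
    exact zero_ne_one (hasSum_zero.unique this)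
  -- With this factor the difference vanishes at the origin.
  refine ⟨h (0, 0) / π (0, 0), fun v => sub_eq_zero.1 ?_⟩
  refine (hb.sub_smul hπ.balanced (h (0, 0) / π (0, 0))).eq_zero hl hμ₁ hμ₂ hp₁ (by linarith) hp₂
    (by linarith) (hs.sub (hπ.hasSum_one.summable.mul_left _)) ?_ v
  field_simp; ring

theorem array_eq_zero {n : ℕ} (ha : ∀ l : ℕ, (n : ℕ∞) < l → a l = 0)
    (hb : ∀ l : ℕ, (n : ℕ∞) < l → b l = 0) {v : ℕ × ℕ} (hv : n < v.1 ∨ n < v.2) :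
    array n lam μ₁ μ₂ a b κ v = 0 := by
  obtain ⟨i, j⟩ := v
  simp only at hv
  have cast : ∀ {k l : ℕ}, n < k → k ≤ l → (n : ℕ∞) < l := fun h₁ h₂ => by
    exact_mod_cast h₁.trans_le h₂
  rcases lt_trichotomy i j with hij | rfl | hij
  · rw [array_of_lt hij, tri_eq_zero fun l hl => hb l (cast (by omega) hl)]
  · have hi : n < i := by omega
    rw [array_self, triDiag_eq_zero ha hb (by exact_mod_cast hi.le),
      if_neg (by exact_mod_cast hi.ne'), add_zero]
  · rw [array_of_gt hij, tri_eq_zero fun l hl => ha l (cast (by omega) hl)]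

/-- For finite K the array has finite support; for K = ⊤ it coincides with `extension`, because κ =
0. -/
theorem summable_array (hκ : K = ⊤ → κ = 0) (he : K = ⊤ → Summable (extension lam μ₁ μ₂ a b)) :
    Summable (array K lam μ₁ μ₂ (trunc K a) (trunc K b) κ) := by
  induction K using ENat.recTopCoe with
  | top =>
    convert he rfl using 1
    funext v
    simp only [array, extension, offDiagSum_eq_tri, diagSum_eq_triDiag, hκ, ite_self, add_zero]
  | coe n =>
    refine summable_of_ne_finset_zero (s := Finset.range (n + 1) ×ˢ Finset.range (n + 1))
      fun v hv => array_eq_zero (fun l hl => trunc_of_lt hl a) (fun l hl => trunc_of_lt hl b) ?_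
    simp only [Finset.mem_product, Finset.mem_range] at hv
    omega

/-- The boundary relations determine the boundary values up to a common factor. -/
theorem BoundaryRelations.eq_smul (hl : 0 < lam) (hμ₁ : 0 < μ₁) (hμ₂ : 0 < μ₂) (hp₁ : 0 ≤ p₁)
    (hp₂ : 0 ≤ p₂) (hp : p₁ + p₂ = 1) (hπ : IsStationary K lam μ₁ μ₂ p₁ p₂ π)
    (hκ : K = ⊤ → κ = 0) (he : K = ⊤ → Summable (extension lam μ₁ μ₂ a b))
    (hr : BoundaryRelations K lam μ₁ μ₂ p₁ p₂ a b κ) :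
    ∃ c : ℝ, (∀ k : ℕ, (k : ℕ∞) ≤ K → a k = c * π (k, 0) ∧ b k = c * π (0, k)) ∧
      κ = c * corner K π := by
  obtain ⟨-, h₁, h₂⟩ := (boundaryRelations_iff hl hμ₁ hμ₂ hκ).1 hr
  have ha : ∀ l : ℕ, K < l → trunc K a l = 0 := fun l hlt => trunc_of_lt hlt a
  have hb : ∀ l : ℕ, K < l → trunc K b l = 0 := fun l hlt => trunc_of_lt hlt b
  obtain ⟨c, hc⟩ := (balanced_array hl hμ₁ hμ₂ hp ha hb h₁ h₂).eq_smul hl hμ₁ hμ₂ hp₁ hp₂ hp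
    (summable_array hκ he) hπ
  refine ⟨c, fun k hk => ?_, ?_⟩
  · rw [← hc, ← hc, ← trunc_of_le hk a, ← trunc_of_le hk b]
    cases k with
    | zero =>
      -- The origin lies on the diagonal, where the array does not involve `tri`. The relations at k
      -- = 0 are what identify a 0 and b 0 with its value there.
      have e₁ := h₁ 0
      have e₂ := h₂ 0
      rw [tri_zero_right hl hμ₁ hμ₂, ← array_self, shift, mul_zero, add_zero] at e₁
      rw [tri_zero_right hl hμ₂ hμ₁, triDiag_comm, ← array_self, shift, mul_zero, add_zero] at e₂
      exact ⟨mul_left_cancel₀ hμ₂.ne' e₁, mul_left_cancel₀ hμ₁.ne' e₂⟩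
    | succ k =>
      rw [array_of_gt (Nat.succ_pos k), array_of_lt (Nat.succ_pos k), tri_zero_right hl hμ₁ hμ₂,
        tri_zero_right hl hμ₂ hμ₁]
      exact ⟨rfl, rfl⟩
  · induction K using ENat.recTopCoe with
    | top => rw [hκ rfl, corner_top, mul_zero]
    | coe n => rw [corner_coe, ← hc, array_self, triDiag_eq_zero ha hb le_rfl, if_pos rfl, zero_add]

theorem IsStationary.le_one (hπ : IsStationary K lam μ₁ μ₂ p₁ p₂ π) (v : ℕ × ℕ) : |π v| ≤ 1 := by
  rw [abs_of_nonneg (hπ.nonneg v)]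
  exact le_hasSum hπ.hasSum_one v fun w _ => hπ.nonneg w

theorem IsStationary.boundary_eq_zero (hπ : IsStationary K lam μ₁ μ₂ p₁ p₂ π) :
    (∀ l : ℕ, K < l → π (l, 0) = 0) ∧ ∀ l : ℕ, K < l → π (0, l) = 0 :=
  ⟨fun l hl => hπ.support _ (by simp [hl]), fun l hl => hπ.support _ (by simp [hl])⟩

theorem corner_smul (c : ℝ) : (corner K fun v => c * π v) = c * corner K π := by
  unfold corner; split_ifs <;> simp

/-- Multiples of the boundary values satisfy the boundary relations. -/
theorem IsStationary.boundaryRelations (hl : 0 < lam) (hμ₁ : 0 < μ₁) (hμ₂ : 0 < μ₂)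
    (hp : p₁ + p₂ = 1) (hπ : IsStationary K lam μ₁ μ₂ p₁ p₂ π) {c : ℝ}
    (hab : ∀ k : ℕ, (k : ℕ∞) ≤ K → a k = c * π (k, 0) ∧ b k = c * π (0, k)) :
    BoundaryRelations K lam μ₁ μ₂ p₁ p₂ a b (c * corner K π) := by
  obtain ⟨z₁, z₂⟩ := hπ.boundary_eq_zero
  have ta : trunc K a = fun l => c * π (l, 0) := by
    funext l
    rcases le_or_gt (l : ℕ∞) K with h | h
    · rw [trunc_of_le h, (hab l h).1]
    · rw [trunc_of_lt h, z₁ l h, mul_zero]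
  have tb : trunc K b = fun l => c * π (0, l) := by
    funext l
    rcases le_or_gt (l : ℕ∞) K with h | h
    · rw [trunc_of_le h, (hab l h).2]
    · rw [trunc_of_lt h, z₂ l h, mul_zero]
  have hbd : ∀ v, |c * π v| ≤ |c| := fun v => by
    rw [abs_mul]
    exact mul_le_of_le_one_right (abs_nonneg c) (hπ.le_one v)
  have hd := diag_eq (K := K) (h := fun v => c * π v) fun v hv => by rw [hπ.support v hv, mul_zero]
  rw [corner_smul] at hd
  have hB := hπ.balanced.smul c
  rw [boundaryRelations_iff hl hμ₁ hμ₂ fun hK => by rw [hK, corner_top, mul_zero], ta, tb]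
  exact ⟨⟨.of_abs_le fun l => hbd (l, 0), .of_abs_le fun l => hbd (0, l)⟩,
    hB.coeffRelation hl hμ₁ hμ₂ hp hd,
    hB.swap.coeffRelation hl hμ₂ hμ₁ (by rwa [add_comm]) hd⟩

theorem IsStationary.summable_extension (hl : 0 < lam) (hμ₁ : 0 < μ₁) (hμ₂ : 0 < μ₂)
    (hp : p₁ + p₂ = 1) (hπ : IsStationary K lam μ₁ μ₂ p₁ p₂ π) {c : ℝ}
    (hab : ∀ k : ℕ, (k : ℕ∞) ≤ K → a k = c * π (k, 0) ∧ b k = c * π (0, k)) (hK : K = ⊤) :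
    Summable (extension lam μ₁ μ₂ a b) := by
  subst hK
  have e := (hπ.balanced.smul c).extension_eq hl hμ₁ hμ₂ hp
  rw [show a = fun l => c * π (l, 0) from funext fun l => (hab l le_top).1,
    show b = fun l => c * π (0, l) from funext fun l => (hab l le_top).2, e]
  exact hπ.hasSum_one.summable.mul_left c

end Stationary

/-! ### Mean arrival and departure rates -/

section Normalization

variable {K : ℕ∞} {lam μ₁ μ₂ p₁ p₂ κ : ℝ} {π : ℕ × ℕ → ℝ}

/-- In equilibrium the mean rates of accepted arrivals and of departures agree. -/
theorem IsStationary.hasSum_drift (hl : 0 < lam) (hμ₁ : 0 < μ₁) (hμ₂ : 0 < μ₂) (hp₁ : 0 ≤ p₁)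
    (hp₂ : 0 ≤ p₂) (hp : p₁ + p₂ = 1) (hπ : IsStationary K lam μ₁ μ₂ p₁ p₂ π) :
    ∑' v : ℕ × ℕ, π v * (arr K lam p₁ v.1 v.2 + arr K lam p₂ v.2 v.1
      - shift (fun _ => μ₁) v.1 - shift (fun _ => μ₂) v.2) = 0 := by
  -- The total length L₁ + L₂ is truncated at n to have a bounded test function. Each jump changes
  -- it by at most one, so the drifts are bounded uniformly in n and dominated convergence applies.
  set f : ℕ → ℕ × ℕ → ℝ := fun n v => ((min (v.1 + v.2) n : ℕ) : ℝ)
  set G : ℕ → ℕ × ℕ → ℝ := fun n v =>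
    gain K lam μ₁ μ₂ p₁ p₂ (f n) v - f n v * outRate K lam μ₁ μ₂ p₁ p₂ v
  have hsum : ∀ n, ∑' v, π v * G n v = 0 := fun n => by
    obtain ⟨s, h₁, h₂⟩ := exists_hasSum_inflow (K := K) (μ₁ := μ₁) (μ₂ := μ₂) (h := π) (f := f n)
      (B := n) hl hp₁ (by linarith) hp₂ (by linarith) hπ.hasSum_one.summable fun v => by
        rw [abs_of_nonneg (Nat.cast_nonneg _)]
        exact Nat.cast_le.2 (min_le_right _ _)
    have := h₂.sub h₁
    rw [sub_self] at this
    refine HasSum.tsum_eq (this.congr_fun fun v => ?_)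
    rw [← hπ.balanced v]
    simp only [G]; ring
  have hstep : ∀ n m : ℕ, |((min (m + 1) n : ℕ) : ℝ) - ((min m n : ℕ) : ℝ)| ≤ 1 := fun n m => by
    rcases Nat.lt_or_ge m n with h | h
    · rw [min_eq_left (by omega : m + 1 ≤ n), min_eq_left h.le]; simp
    · rw [min_eq_right (by omega : n ≤ m + 1), min_eq_right h]; simp
  have hG : ∀ n i j, G n (i, j) =
      arr K lam p₁ i j * (((min (i + j + 1) n : ℕ) : ℝ) - ((min (i + j) n : ℕ) : ℝ))
      + arr K lam p₂ j i * (((min (i + j + 1) n : ℕ) : ℝ) - ((min (i + j) n : ℕ) : ℝ))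
      - shift (fun i => μ₁ * (((min (i + j + 1) n : ℕ) : ℝ) - ((min (i + j) n : ℕ) : ℝ))) i
      - shift (fun j => μ₂ * (((min (i + j + 1) n : ℕ) : ℝ) - ((min (i + j) n : ℕ) : ℝ))) j := by
    intro n i j
    cases i <;> cases j <;>
      simp only [G, gain, outRate, f, shift, add_assoc, add_left_comm, add_comm] <;> ring
  have habs : ∀ (φ : ℕ → ℝ) (B : ℝ), 0 ≤ B → (∀ k, |φ k| ≤ B) → ∀ k, |shift φ k| ≤ B := by
    intro φ B hB hφ k
    cases k with
    | zero => simpa [shift] using hB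
    | succ k => exact hφ k
  have hμle : ∀ {μ t : ℝ}, 0 < μ → |t| ≤ 1 → |μ * t| ≤ μ := fun hμ ht => by
    rw [abs_mul, abs_of_pos hμ]; exact mul_le_of_le_one_right hμ.le ht
  have hbound : ∀ n v, ‖π v * G n v‖ ≤ π v * (2 * lam * 1 + 2 * lam * 1 + μ₁ + μ₂) := by
    rintro n ⟨i, j⟩
    rw [Real.norm_eq_abs, abs_mul, abs_of_nonneg (hπ.nonneg _)]
    refine mul_le_mul_of_nonneg_left ?_ (hπ.nonneg _)
    rw [hG]
    refine (abs_sub _ _).trans (add_le_add ((abs_sub _ _).trans (add_le_add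
      ((abs_add_le _ _).trans (add_le_add ?_ ?_)) ?_)) ?_)
    · exact abs_arr_mul_le hl hp₁ (by linarith) (hstep _ _) _ _
    · exact abs_arr_mul_le hl hp₂ (by linarith) (hstep _ _) _ _
    · exact habs _ _ hμ₁.le (fun k => hμle hμ₁ (hstep _ _)) _
    · exact habs _ _ hμ₂.le (fun k => hμle hμ₂ (hstep _ _)) _
  have hlim : ∀ v : ℕ × ℕ, Tendsto (fun n => π v * G n v) atTop
      (𝓝 (π v * (arr K lam p₁ v.1 v.2 + arr K lam p₂ v.2 v.1
        - shift (fun _ => μ₁) v.1 - shift (fun _ => μ₂) v.2))) := by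
    rintro ⟨i, j⟩
    refine tendsto_const_nhds.congr' ?_
    filter_upwards [eventually_ge_atTop (i + j + 1)] with n hn
    rw [hG]
    have e : ∀ m, m + 1 ≤ n → ((min (m + 1) n : ℕ) : ℝ) - ((min m n : ℕ) : ℝ) = 1 := fun m hm => by
      rw [min_eq_left hm, min_eq_left (by omega)]; simp
    have t₁ : shift (fun i => μ₁ *
        (((min (i + j + 1) n : ℕ) : ℝ) - ((min (i + j) n : ℕ) : ℝ))) i = shift (fun _ => μ₁) i := by
      cases i with
      | zero => rfl
      | succ i => simp only [shift]; rw [e _ (by omega), mul_one]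
    have t₂ : shift (fun j => μ₂ *
        (((min (i + j + 1) n : ℕ) : ℝ) - ((min (i + j) n : ℕ) : ℝ))) j = shift (fun _ => μ₂) j := by
      cases j with
      | zero => rfl
      | succ j => simp only [shift]; rw [e _ (by omega), mul_one]
    rw [t₁, t₂, e _ hn, mul_one, mul_one]
  have := tendsto_tsum_of_dominated_convergence (hπ.hasSum_one.summable.mul_right _) hlim
    (Eventually.of_forall hbound)
  simp only [hsum] at this
  exact (tendsto_nhds_unique this tendsto_const_nhds)

theorem hasSum_corner : HasSum (fun v : ℕ × ℕ => if v.1 = v.2 ∧ (v.1 : ℕ∞) = K then π v else 0)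
    (corner K π) := by
  induction K using ENat.recTopCoe with
  | top => simp [corner_top]
  | coe n =>
    rw [corner_coe]
    have := hasSum_single (f := fun v : ℕ × ℕ => if v.1 = v.2 ∧ (v.1 : ℕ∞) = n then π v else 0)
      (n, n) fun v hv => by
        rw [if_neg]
        rintro ⟨h₁, h₂⟩
        have h₃ : v.1 = n := by exact_mod_cast h₂
        exact hv (Prod.ext h₃ (h₁ ▸ h₃))
    simpa using this

/-- Arrivals are accepted at rate 2λ except at (K, K), and server i works unless queue i is empty.
The vanishing drift thus reads 2λ(1 - κ) = μ₁(1 - P(L₁ = 0)) + μ₂(1 - P(L₂ = 0)). -/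
theorem IsStationary.normalization_real (hl : 0 < lam) (hμ₁ : 0 < μ₁) (hμ₂ : 0 < μ₂)
    (hp₁ : 0 ≤ p₁) (hp₂ : 0 ≤ p₂) (hp : p₁ + p₂ = 1)
    (hπ : IsStationary K lam μ₁ μ₂ p₁ p₂ π) :
    (Summable fun l => π (l, 0)) ∧ (Summable fun l => π (0, l)) ∧
      μ₂ * ∑' l, π (l, 0) + μ₁ * ∑' l, π (0, l) = μ₁ + μ₂ - 2 * lam * (1 - corner K π) := by
  have i₁ : Function.Injective fun l : ℕ => (l, 0) := fun l m e => by simpa using e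
  have i₂ : Function.Injective fun l : ℕ => (0, l) := fun l m e => by simpa using e
  have s₁ : Summable fun l => π (l, 0) := hπ.hasSum_one.summable.comp_injective i₁
  have s₂ : Summable fun l => π (0, l) := hπ.hasSum_one.summable.comp_injective i₂
  refine ⟨s₁, s₂, ?_⟩
  have h₁ : HasSum (fun v : ℕ × ℕ => if v.2 = 0 then π v else 0) (∑' l, π (l, 0)) := by
    rw [← i₁.hasSum_iff]
    · exact s₁.hasSum.congr_fun fun l => by simp
    · rintro ⟨i, j⟩ hv
      rw [if_neg]
      rintro rfl
      exact hv ⟨i, rfl⟩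
  have h₂ : HasSum (fun v : ℕ × ℕ => if v.1 = 0 then π v else 0) (∑' l, π (0, l)) := by
    rw [← i₂.hasSum_iff]
    · exact s₂.hasSum.congr_fun fun l => by simp
    · rintro ⟨i, j⟩ hv
      rw [if_neg]
      rintro rfl
      exact hv ⟨j, rfl⟩
  have total := (((hπ.hasSum_one.sub (hasSum_corner (K := K) (π := π))).mul_left (2 * lam)).sub
    ((hπ.hasSum_one.sub h₂).mul_left μ₁)).sub ((hπ.hasSum_one.sub h₁).mul_left μ₂)
  have e := hπ.hasSum_drift hl hμ₁ hμ₂ hp₁ hp₂ hp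
  rw [HasSum.tsum_eq (total.congr_fun fun v => ?_)] at e
  · linear_combination e
  · obtain ⟨i, j⟩ := v
    have ht : ∀ (μ : ℝ) (i : ℕ), shift (fun _ => μ) i = μ - if i = 0 then μ else 0 := fun μ i => by
      cases i <;> simp [shift]
    have ha : π (i, j) * (arr K lam p₁ i j + arr K lam p₂ j i) =
        2 * lam * (π (i, j) - if i = j ∧ (i : ℕ∞) = K then π (i, j) else 0) := by
      rcases lt_trichotomy i j with hij | rfl | hij
      · rw [arr_of_lt hij, arr_of_gt hij, if_neg (by omega)]; ring
      · have hd := diag_eq hπ.support i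
        have hc : (if (i : ℕ∞) = K then corner K π else 0) =
            if (i : ℕ∞) = K then π (i, i) else 0 := by
          split_ifs with h
          · rw [← h, corner_coe]
          · rfl
        rw [hc] at hd
        rw [arr_self, arr_self]
        simp only [true_and]
        linear_combination 2 * lam * below K i * π (i, i) * hp - 2 * lam * hd
      · rw [arr_of_lt hij, arr_of_gt hij, if_neg (by omega)]; ring
    simp only [ht]
    split_ifs at ha ⊢ <;> linear_combination ha

/-- Here the whole right-hand side scales with c, whereas in the normalization relation only κ does.
Comparing the two determines c. -/
theorem IsStationary.normalization (hl : 0 < lam) (hμ₁ : 0 < μ₁) (hμ₂ : 0 < μ₂)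
    (hp₁ : 0 ≤ p₁) (hp₂ : 0 ≤ p₂) (hp : p₁ + p₂ = 1)
    (hπ : IsStationary K lam μ₁ μ₂ p₁ p₂ π) {a b : ℕ → ℝ} {c : ℝ}
    (hab : ∀ k : ℕ, (k : ℕ∞) ≤ K → a k = c * π (k, 0) ∧ b k = c * π (0, k)) :
    Summable (genTerm K a 1) ∧ Summable (genTerm K b 1) ∧
      (μ₂ * gen K a 1 + μ₁ * gen K b 1 : ℂ) =
        c * (μ₁ + μ₂ - 2 * lam * (1 - corner K π) : ℝ) := by
  obtain ⟨s₁, s₂, e⟩ := hπ.normalization_real hl hμ₁ hμ₂ hp₁ hp₂ hp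
  obtain ⟨z₁, z₂⟩ := hπ.boundary_eq_zero
  have key : ∀ {a f : ℕ → ℝ}, Summable f → (∀ l : ℕ, K < l → f l = 0) →
      (∀ k : ℕ, (k : ℕ∞) ≤ K → a k = c * f k) →
      HasSum (genTerm K a 1) (c * ((∑' l, f l : ℝ) : ℂ)) := by
    intro a f hf hz ha
    refine ((Complex.hasSum_ofReal.2 hf.hasSum).mul_left (c : ℂ)).congr_fun fun k => ?_
    rw [genTerm]
    split_ifs with hk
    · rw [ha k hk]; simp
    · rw [hz k (not_le.1 hk)]; simp
  have k₁ := key s₁ z₁ fun k hk => (hab k hk).1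
  have k₂ := key s₂ z₂ fun k hk => (hab k hk).2
  refine ⟨k₁.summable, k₂.summable, ?_⟩
  rw [gen, gen, k₁.tsum_eq, k₂.tsum_eq, ← e]
  push_cast; ring

end Normalization

end JSQ

end

/-! ### The main theorem -/

theorem mainTheorem11 (K : ℕ∞) (lam μ₁ μ₂ p₁ p₂ : ℝ)
    (hlam : 0 < lam) (hμ₁ : 0 < μ₁) (hμ₂ : 0 < μ₂)
    (hp₁ : 0 ≤ p₁) (hp₂ : 0 ≤ p₂) (hp : p₁ + p₂ = 1)
    (hK : K = ⊤ → 2 * lam < μ₁ + μ₂)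
    (π : ℕ × ℕ → ℝ) (hπ : JSQ.IsStationary K lam μ₁ μ₂ p₁ p₂ π) :
    -- (i) explicit expressions in terms of the boundary values
    ((∀ k j : ℕ, j < k → (k : ℕ∞) ≤ K →
        π (k, j) = μ₂ / μ₁ *
          JSQ.offDiagSum K (JSQ.g lam μ₁ μ₂) (fun l => π (l, 0)) k j) ∧
      (∀ k j : ℕ, j < k → (k : ℕ∞) ≤ K →
        π (j, k) = μ₁ / μ₂ *
          JSQ.offDiagSum K (JSQ.g lam μ₂ μ₁) (fun l => π (0, l)) k j) ∧
      (∀ k : ℕ, (k : ℕ∞) < K →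
        π (k, k) = JSQ.diagSum K lam μ₁ μ₂ (fun l => π (l, 0)) (fun l => π (0, l)) k) ∧
      (∀ k : ℕ, (k : ℕ∞) = K → 1 ≤ k →
        π (k, k) = 2 * lam / (μ₁ + μ₂) *
          (μ₂ / μ₁ * π (k, 0) * (JSQ.g lam μ₁ μ₂ (k - 1) - JSQ.g lam μ₁ μ₂ k)
            + μ₁ / μ₂ * π (0, k) * (JSQ.g lam μ₂ μ₁ (k - 1) - JSQ.g lam μ₂ μ₁ k)))) ∧
    -- (ii) the functional equations hold, and characterize up to a common constant
    (JSQ.BoundaryRelations K lam μ₁ μ₂ p₁ p₂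
        (fun l => π (l, 0)) (fun l => π (0, l)) (JSQ.corner K π) ∧
      (∀ (a b : ℕ → ℝ) (κ : ℝ), (K = ⊤ → κ = 0) →
        (((K = ⊤ → Summable (JSQ.extension lam μ₁ μ₂ a b)) ∧
            JSQ.BoundaryRelations K lam μ₁ μ₂ p₁ p₂ a b κ) ↔
          ∃ c : ℝ, (∀ k : ℕ, (k : ℕ∞) ≤ K → a k = c * π (k, 0) ∧ b k = c * π (0, k)) ∧
            κ = c * JSQ.corner K π))) ∧
    -- (iii) the normalization relation holds, and completes the characterization
    (JSQ.Normalization K lam μ₁ μ₂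
        (fun l => π (l, 0)) (fun l => π (0, l)) (JSQ.corner K π) ∧
      (2 * lam ≠ μ₁ + μ₂ → ∀ (a b : ℕ → ℝ) (κ : ℝ), (K = ⊤ → κ = 0) →
        (((K = ⊤ → Summable (JSQ.extension lam μ₁ μ₂ a b)) ∧
            JSQ.BoundaryRelations K lam μ₁ μ₂ p₁ p₂ a b κ ∧
            JSQ.Normalization K lam μ₁ μ₂ a b κ) ↔
          (∀ k : ℕ, (k : ℕ∞) ≤ K → a k = π (k, 0) ∧ b k = π (0, k)) ∧
            κ = JSQ.corner K π))) := by
  obtain ⟨z₁, z₂⟩ := hπ.boundary_eq_zero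
  have hb := hπ.balanced
  have hp' : p₂ + p₁ = 1 := by rwa [add_comm]
  have self : ∀ k : ℕ, (k : ℕ∞) ≤ K → π (k, 0) = 1 * π (k, 0) ∧ π (0, k) = 1 * π (0, k) :=
    fun k _ => ⟨(one_mul _).symm, (one_mul _).symm⟩
  have norm_iff : JSQ.Normalization K lam μ₁ μ₂ (fun l => π (l, 0)) (fun l => π (0, l))
      (JSQ.corner K π) := by
    obtain ⟨s₁, s₂, e⟩ := hπ.normalization hlam hμ₁ hμ₂ hp₁ hp₂ hp self
    refine ⟨s₁, s₂, e.trans ?_⟩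
    push_cast; ring
  have iff : ∀ (a b : ℕ → ℝ) (κ : ℝ), (K = ⊤ → κ = 0) →
      (((K = ⊤ → Summable (JSQ.extension lam μ₁ μ₂ a b)) ∧
          JSQ.BoundaryRelations K lam μ₁ μ₂ p₁ p₂ a b κ) ↔
        ∃ c : ℝ, (∀ k : ℕ, (k : ℕ∞) ≤ K → a k = c * π (k, 0) ∧ b k = c * π (0, k)) ∧
          κ = c * JSQ.corner K π) := by
    intro a b κ hκ
    constructor
    · rintro ⟨he, hr⟩
      exact hr.eq_smul hlam hμ₁ hμ₂ hp₁ hp₂ hp hπ hκ he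
    · rintro ⟨c, hab, rfl⟩
      exact ⟨hπ.summable_extension hlam hμ₁ hμ₂ hp hab,
        hπ.boundaryRelations hlam hμ₁ hμ₂ hp hab⟩
  refine ⟨⟨fun k j hjk _ => hb.eq_offDiagSum hlam hμ₁ hμ₂ z₁ hjk,
    fun k j hjk _ => hb.swap.eq_offDiagSum hlam hμ₂ hμ₁ z₂ hjk,
    fun k hk => hb.eq_diagSum hlam hμ₁ hμ₂ hp z₁ z₂ hk, ?_⟩, ⟨?_, iff⟩, norm_iff, ?_⟩
  · rintro k rfl hk
    exact hb.corner_eq hlam hμ₁ hμ₂ hp hk hπ.support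
  · simpa using hπ.boundaryRelations hlam hμ₁ hμ₂ hp self
  · intro hne a b κ hκ
    constructor
    · rintro ⟨he, hr, -, -, hn⟩
      obtain ⟨c, hab, rfl⟩ := (iff a b κ hκ).1 ⟨he, hr⟩
      obtain ⟨-, -, e⟩ := hπ.normalization hlam hμ₁ hμ₂ hp₁ hp₂ hp hab
      have e' : c * (μ₁ + μ₂ - 2 * lam * (1 - JSQ.corner K π)) =
          μ₁ + μ₂ - 2 * lam * (1 - c * JSQ.corner K π) := by
        exact_mod_cast e.symm.trans hn
      -- The corner terms cancel, so the condition on c involves the rates alone.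
      have hc : (c - 1) * (μ₁ + μ₂ - 2 * lam) = 0 := by linear_combination e'
      obtain rfl : c = 1 := by
        rcases mul_eq_zero.1 hc with h | h
        · linarith
        · exact absurd (by linarith) hne
      exact ⟨by simpa using hab, one_mul _⟩
    · rintro ⟨hab, rfl⟩
      have hab' : ∀ k : ℕ, (k : ℕ∞) ≤ K → a k = 1 * π (k, 0) ∧ b k = 1 * π (0, k) := by
        simpa using hab
      obtain ⟨he, hr⟩ := (iff a b _ hκ).2 ⟨1, hab', (one_mul _).symm⟩
      obtain ⟨s₁, s₂, e⟩ := hπ.normalization hlam hμ₁ hμ₂ hp₁ hp₂ hp hab'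
      refine ⟨he, hr, s₁, s₂, e.trans ?_⟩
      push_cast; ring
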